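/- Let $k$ be a commutative ring and $H$ a Hopf algebra over $k$ with bijective antipode $S$, projective as a $k$-module. For a right $H$-comodule algebra $A$ (a $k$-algebra with a coaction satisfying $\rho(1)=1\otimes1$, $\rho(ab)=a_{[0]}b_{[0]}\otimes a_{[1]}b_{[1]}$), let $A^{{\rm co}H}=\{a\in A:\rho(a)=a\otimes 1\}$; $A$ is an $H$-Galois extension of $A^{{\rm co}H}$ if ${\rm can}:A\otimes_{A^{{\rm co}H}}A\to A\otimes H$, ${\rm can}(a\otimes b)=ab_{[0]}\otimes b_{[1]}$, is bijective. A relative Hopf module over $A$ is a left $A$-module and right $H$-comodule $V$ with $\rho(av)=a_{[0]}v_{[0]}\otimes a_{[1]}v_{[1]}$. For relative Hopf modules $V,W$, let ${}_A{\rm HOM}(V,W)$ be the $k$-module of left $A$-linear maps $f:V\to W$ for which there is a (necessarily unique) $f_{[0]}\otimes f_{[1]}\in{}_A{\rm Hom}(V,W)\otimes H$ with $f_{[0]}(v)\otimes f_{[1]}=f(v_{[0]})_{[0]}\otimes S^{-1}(v_{[1]})f(v_{[0]})_{[1]}$ for all $v\in V$; it is a right $H$-comodule via $\rho(f)=f_{[0]}\otimes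 f_{[1]}$. Let ${}_A\underline{\mathcal M}^H$ be the category of relative Hopf modules over $A$ with the sets ${}_A{\rm HOM}(V,W)$ as morphisms. A functor $F:{}_A\underline{\mathcal M}^H\to{}_B\underline{\mathcal M}^H$ is $H$-colinear if all the maps $F:{}_A{\rm HOM}(V,W)\to{}_B{\rm HOM}(F(V),F(W))$ are morphisms of right $H$-comodules. Write $F\cong G$ if there is a natural isomorphism $F\to G$ whose components are $H$-colinear. A pair of $H$-colinear inverse equivalences is a pair of $H$-colinear functors $T:{}_A\underline{\mathcal M}^H\to{}_B\underline{\mathcal M}^H$, $U:{}_B\underline{\mathcal M}^H\to{}_A\underline{\mathcal M}^H$ with $U\circ T\cong{\rm Id}$ and $T\circ U\cong{\rm Id}$. A strict $H$-Morita context $(A,B,M,N,\alpha,\beta)$ consists of an $(A,B)$-bimodule $M$ and a $(B,A)$-bimodule $N$ (with $k$ acting centrally), both right $H$-comodules with $\rho(amb)=a_{[0]}m_{[0]}b_{[0]}\otimes a_{[1]}m_{[1]}b_{[1]}$ and $\rho(bna)=b_{[0]}n_{[0]}a_{[0]}\otimes b_{[1]}n_{[1]}a_{[1]}$, and of bijective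 $H$-colinear bimodule maps $\alpha:M\otimes_BN\to A$, $\beta:N\otimes_AM\to B$ such that $\alpha(m\otimes n)m'=m\beta(n\otimes m')$ and $\beta(n\otimes m)n'=n\alpha(m\otimes n')$; tensor products carry the coaction $\rho(x\otimes y)=x_{[0]}\otimes y_{[0]}\otimes x_{[1]}y_{[1]}$. Corollary. Let $A$ and $B$ be right $H$-comodule algebras that are $H$-Galois extensions of $A^{{\rm co}H}$ and $B^{{\rm co}H}$, respectively. If $(T,U)$ is a pair of $H$-colinear inverse equivalences between ${}_A\underline{\mathcal M}^H$ and ${}_B\underline{\mathcal M}^H$, then there is a strict $H$-Morita context $(A,B,M,N,\alpha,\beta)$ such that $T\cong N\otimes_A-$ and $U\cong M\otimes_B-$. -/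

import Mathlib

open CategoryTheory TensorProduct

universe u

namespace HopfMorita

section Comodules

/-- The antipode of the Hopf algebra `H` is bijective. -/
class HasBijectiveAntipode (k H : Type u) [CommRing k] [Ring H] [HopfAlgebra k H] : Prop where
  bijective : Function.Bijective (HopfAlgebra.antipode k (A := H))

/-- A right `H`-comodule structure on the `k`-module `M`:
a coassociative and counital coaction `ρ(m) = m₀ ⊗ m₁`. -/
class RightComodule (k H M : Type u) [CommRing k] [Ring H] [HopfAlgebra k H]
    [AddCommGroup M] [Module k M] where
  coact : M →ₗ[k] M ⊗[k] H
  coassoc : ∀ m : M, TensorProduct.assoc k M H H (coact.rTensor H (coact m)) =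
    (Coalgebra.comul (R := k) (A := H)).lTensor M (coact m)
  counit : ∀ m : M,
    TensorProduct.rid k M ((Coalgebra.counit (R := k) (A := H)).lTensor M (coact m)) = m

variable (k H : Type u) [CommRing k] [Ring H] [HopfAlgebra k H]

/-- The coaction of a right `H`-comodule. -/
def rho {M : Type u} [AddCommGroup M] [Module k M] [RightComodule k H M] :
    M →ₗ[k] M ⊗[k] H :=
  RightComodule.coact

/-- A `k`-linear map is right `H`-colinear: `ρ(f(m)) = f(m₀) ⊗ m₁`. -/
def Colinear {M N : Type u} [AddCommGroup M] [Module k M] [RightComodule k H M]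
    [AddCommGroup N] [Module k N] [RightComodule k H N] (f : M →ₗ[k] N) : Prop :=
  ∀ m : M, rho k H (f m) = f.rTensor H (rho k H m)

/-- The diagonal extension of a bilinear pairing:
`(x ⊗ h, y ⊗ g) ↦ p(x, y) ⊗ hg`. -/
noncomputable def diag {X Y Z : Type u} [AddCommGroup X] [Module k X] [AddCommGroup Y] [Module k Y]
    [AddCommGroup Z] [Module k Z] (p : X →ₗ[k] Y →ₗ[k] Z) :
    X ⊗[k] H →ₗ[k] Y ⊗[k] H →ₗ[k] Z ⊗[k] H :=
  TensorProduct.map₂ p (LinearMap.mul k H)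

@[simp] theorem diag_tmul {X Y Z : Type u} [AddCommGroup X] [Module k X] [AddCommGroup Y]
    [Module k Y] [AddCommGroup Z] [Module k Z] (p : X →ₗ[k] Y →ₗ[k] Z) (x : X) (y : Y) (h g : H) :
    diag k H p (x ⊗ₜ h) (y ⊗ₜ g) = p x y ⊗ₜ (h * g) := by
  simp [diag]

theorem diag_assoc {X Y Z P Q R : Type u} [AddCommGroup X] [Module k X] [AddCommGroup Y]
    [Module k Y] [AddCommGroup Z] [Module k Z] [AddCommGroup P] [Module k P]
    [AddCommGroup Q] [Module k Q] [AddCommGroup R] [Module k R]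
    (q : X →ₗ[k] Y →ₗ[k] P) (p : P →ₗ[k] Z →ₗ[k] R)
    (q' : Y →ₗ[k] Z →ₗ[k] Q) (p' : X →ₗ[k] Q →ₗ[k] R)
    (h : ∀ x y z, p (q x y) z = p' x (q' y z))
    (a : X ⊗[k] H) (b : Y ⊗[k] H) (c : Z ⊗[k] H) :
    diag k H p (diag k H q a b) c = diag k H p' a (diag k H q' b c) := by
  induction a using TensorProduct.induction_on with
  | zero => simp
  | add a a' ha ha' => simp only [map_add, LinearMap.add_apply, ha, ha']
  | tmul x l =>
    induction b using TensorProduct.induction_on with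
    | zero => simp
    | add b b' hb hb' => simp only [map_add, LinearMap.add_apply, hb, hb']
    | tmul y m =>
      induction c using TensorProduct.induction_on with
      | zero => simp
      | add c c' hc hc' => simp only [map_add, hc, hc']
      | tmul z n => simp [h, mul_assoc]

theorem diag_rTensor {X Y Y' Z : Type u} [AddCommGroup X] [Module k X] [AddCommGroup Y]
    [Module k Y] [AddCommGroup Y'] [Module k Y'] [AddCommGroup Z] [Module k Z]
    (p : X →ₗ[k] Y →ₗ[k] Z) (L : Y' →ₗ[k] Y) (x : X ⊗[k] H) (y : Y' ⊗[k] H) :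
    diag k H p x (L.rTensor H y) = diag k H (p.compl₂ L) x y := by
  induction x using TensorProduct.induction_on with
  | zero => simp
  | add x x' hx hx' => simp only [map_add, LinearMap.add_apply, hx, hx']
  | tmul a h =>
    induction y using TensorProduct.induction_on with
    | zero => simp
    | add y y' hy hy' => simp only [map_add, hy, hy']
    | tmul b g => simp

/-- `(id ⊗ φ) : X ⊗ H → X` for a functional `φ` on `H`. -/
noncomputable def slice {Y : Type u} [AddCommGroup Y] [Module k Y] (φ : H →ₗ[k] k) :
    Y ⊗[k] H →ₗ[k] Y :=
  (TensorProduct.rid k Y).toLinearMap ∘ₗ φ.lTensor Y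

@[simp] theorem slice_tmul {Y : Type u} [AddCommGroup Y] [Module k Y] (φ : H →ₗ[k] k)
    (y : Y) (h : H) : slice k H φ (y ⊗ₜ[k] h) = φ h • y := by
  simp [slice]

theorem slice_counit_diag {X Y Z : Type u} [AddCommGroup X] [Module k X] [AddCommGroup Y]
    [Module k Y] [AddCommGroup Z] [Module k Z] (p : X →ₗ[k] Y →ₗ[k] Z)
    (x : X ⊗[k] H) (y : Y ⊗[k] H) :
    slice k H (Coalgebra.counit (R := k) (A := H)) (diag k H p x y) =
      p (slice k H (Coalgebra.counit (R := k) (A := H)) x)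
        (slice k H (Coalgebra.counit (R := k) (A := H)) y) := by
  induction x using TensorProduct.induction_on with
  | zero => simp
  | add x x' hx hx' => simp only [map_add, LinearMap.add_apply, hx, hx']
  | tmul a h =>
    induction y using TensorProduct.induction_on with
    | zero => simp
    | add y y' hy hy' => simp only [map_add, hy, hy']
    | tmul b g =>
      simp only [diag_tmul, slice_tmul, Bialgebra.counit_mul, map_smul, LinearMap.smul_apply,
        mul_smul]
      exact smul_comm _ _ _

end Comodules

section Modules

variable (k : Type u) [CommRing k]

/-- The left action of a `k`-algebra as a bilinear map `(a, m) ↦ a m`. -/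
def leftAct (A M : Type u) [Ring A] [Algebra k A] [AddCommGroup M] [Module k M]
    [Module A M] [IsScalarTower k A M] : A →ₗ[k] M →ₗ[k] M :=
  (Algebra.lsmul k k M).toLinearMap

@[simp] theorem leftAct_apply (A M : Type u) [Ring A] [Algebra k A] [AddCommGroup M] [Module k M]
    [Module A M] [IsScalarTower k A M] (a : A) (m : M) : leftAct k A M a m = a • m := rfl

/-- The right action of a `k`-algebra as a bilinear map `(m, a) ↦ m a`. -/
def rightAct (A M : Type u) [Ring A] [Algebra k A] [AddCommGroup M] [Module k M]
    [Module Aᵐᵒᵖ M] [IsScalarTower k Aᵐᵒᵖ M] : M →ₗ[k] A →ₗ[k] M :=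
  (leftAct k Aᵐᵒᵖ M ∘ₗ (MulOpposite.opLinearEquiv k).toLinearMap).flip

@[simp] theorem rightAct_apply (A M : Type u) [Ring A] [Algebra k A] [AddCommGroup M] [Module k M]
    [Module Aᵐᵒᵖ M] [IsScalarTower k Aᵐᵒᵖ M] (m : M) (a : A) :
    rightAct k A M m a = MulOpposite.op a • m := rfl

end Modules

section Algebras

/-- A right `H`-comodule algebra: a `k`-algebra that is a right `H`-comodule
such that `ρ(1) = 1 ⊗ 1` and `ρ(ab) = a₀b₀ ⊗ a₁b₁`. -/
class ComoduleAlgebra (k H A : Type u) [CommRing k] [Ring H] [HopfAlgebra k H] [Ring A]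
    [Algebra k A] extends RightComodule k H A where
  coact_one : coact 1 = 1 ⊗ₜ[k] 1
  coact_mul : ∀ a b : A, coact (a * b) = diag k H (LinearMap.mul k A) (coact a) (coact b)

variable (k H A : Type u) [CommRing k] [Ring H] [HopfAlgebra k H] [Ring A] [Algebra k A]
  [ComoduleAlgebra k H A]

/-- `a ∈ A` is coinvariant, i.e. `a ∈ A^{co H}`: `ρ(a) = a ⊗ 1`. -/
def IsCoinvariant (a : A) : Prop := rho k H a = a ⊗ₜ[k] (1 : H)

/-- The relations `ar ⊗ b - a ⊗ rb`, `r ∈ A^{co H}`, in `A ⊗ A`. -/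
def coinvRel : Submodule k (A ⊗[k] A) :=
  Submodule.span k {t | ∃ a r b : A, IsCoinvariant k H A r ∧
    t = (a * r) ⊗ₜ[k] b - a ⊗ₜ[k] (r * b)}

/-- The map `A ⊗ A → A ⊗ H`, `a ⊗ b ↦ a b₀ ⊗ b₁`. -/
noncomputable def preCan : A ⊗[k] A →ₗ[k] A ⊗[k] H :=
  (LinearMap.mul' k A).rTensor H ∘ₗ (TensorProduct.assoc k A A H).symm.toLinearMap ∘ₗ
    (rho k H (M := A)).lTensor A

theorem preCan_tmul (a b : A) :
    preCan k H A (a ⊗ₜ b) = diag k H (LinearMap.mul k A) (a ⊗ₜ 1) (rho k H b) := by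
  simp only [preCan, LinearMap.comp_apply, LinearMap.lTensor_tmul]
  induction rho k H b using TensorProduct.induction_on with
  | zero => simp
  | add x y hx hy => simp only [TensorProduct.tmul_add, map_add, hx, hy]
  | tmul x h => simp

theorem coinvRel_le_ker : coinvRel k H A ≤ LinearMap.ker (preCan k H A) := by
  refine Submodule.span_le.2 ?_
  rintro _ ⟨a, r, b, hr, rfl⟩
  have hr' : rho k H r = r ⊗ₜ[k] (1 : H) := hr
  have hm : rho k H (r * b) = diag k H (LinearMap.mul k A) (rho k H r) (rho k H b) :=
    ComoduleAlgebra.coact_mul r b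
  rw [SetLike.mem_coe, LinearMap.mem_ker, map_sub, preCan_tmul, preCan_tmul, hm, hr',
    ← diag_assoc k H (LinearMap.mul k A) (LinearMap.mul k A) (LinearMap.mul k A)
      (LinearMap.mul k A) (fun x y z => mul_assoc x y z)]
  simp

/-- The canonical map `can : A ⊗_{A^{co H}} A → A ⊗ H`, `a ⊗ b ↦ a b₀ ⊗ b₁`. -/
noncomputable def can : (A ⊗[k] A) ⧸ coinvRel k H A →ₗ[k] A ⊗[k] H :=
  (coinvRel k H A).liftQ (preCan k H A) (coinvRel_le_ker k H A)

/-- `A` is an `H`-Galois extension of `A^{co H}`: the canonical map is bijective. -/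
def IsHopfGalois : Prop := Function.Bijective (can k H A)

end Algebras

section RationalHom

set_option linter.unusedSectionVars false

variable (k H : Type u) [CommRing k] [Ring H] [HopfAlgebra k H]

/-- The inverse `S⁻¹` of the antipode. -/
noncomputable def antipodeInv [HasBijectiveAntipode k H] : H →ₗ[k] H :=
  (LinearEquiv.ofBijective (HopfAlgebra.antipode k (A := H))
    HasBijectiveAntipode.bijective).symm.toLinearMap

variable [HasBijectiveAntipode k H]

theorem antipode_antipodeInv (h : H) : HopfAlgebra.antipode k (antipodeInv k H h) = h :=
  (LinearEquiv.ofBijective (HopfAlgebra.antipode k (A := H))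
    HasBijectiveAntipode.bijective).apply_symm_apply h

/-- `h ⊗ g ↦ S⁻¹(g) h`. -/
noncomputable def mulInvL : H ⊗[k] H →ₗ[k] H :=
  TensorProduct.lift ((LinearMap.mul k H ∘ₗ antipodeInv k H).flip)

/-- `h ⊗ g ↦ g S⁻¹(h)`. -/
noncomputable def mulInvR : H ⊗[k] H →ₗ[k] H :=
  TensorProduct.lift ((LinearMap.mul k H).flip ∘ₗ antipodeInv k H)

@[simp] theorem mulInvL_tmul (h g : H) : mulInvL k H (h ⊗ₜ g) = antipodeInv k H g * h := rfl

@[simp] theorem mulInvR_tmul (h g : H) : mulInvR k H (h ⊗ₜ g) = g * antipodeInv k H h := rfl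

theorem mulInvL_comul (h : H) :
    mulInvL k H (Coalgebra.comul h) = algebraMap k H (Coalgebra.counit h) := by
  apply (HasBijectiveAntipode.bijective (k := k) (H := H)).1
  rw [Algebra.algebraMap_eq_smul_one, map_smul, HopfAlgebra.antipode_one,
    ← Algebra.algebraMap_eq_smul_one, ← HopfAlgebra.mul_antipode_rTensor_comul_apply]
  induction (Coalgebra.comul h : H ⊗[k] H) using TensorProduct.induction_on with
  | zero => simp
  | add x y hx hy => simp only [map_add, hx, hy]
  | tmul x y =>
    rw [mulInvL_tmul, HopfAlgebra.antipode_mul_antidistrib, antipode_antipodeInv]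
    simp

theorem mulInvR_comul (h : H) :
    mulInvR k H (Coalgebra.comul h) = algebraMap k H (Coalgebra.counit h) := by
  apply (HasBijectiveAntipode.bijective (k := k) (H := H)).1
  rw [Algebra.algebraMap_eq_smul_one, map_smul, HopfAlgebra.antipode_one,
    ← Algebra.algebraMap_eq_smul_one, ← HopfAlgebra.mul_antipode_lTensor_comul_apply]
  induction (Coalgebra.comul h : H ⊗[k] H) using TensorProduct.induction_on with
  | zero => simp
  | add x y hx hy => simp only [map_add, hx, hy]
  | tmul x y =>
    rw [mulInvR_tmul, HopfAlgebra.antipode_mul_antidistrib, antipode_antipodeInv]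
    simp

/-- `(w ⊗ h) ⊗ g ↦ w ⊗ S⁻¹(g) h`. -/
noncomputable def twist (W : Type u) [AddCommGroup W] [Module k W] :
    (W ⊗[k] H) ⊗[k] H →ₗ[k] W ⊗[k] H :=
  (mulInvL k H).lTensor W ∘ₗ (TensorProduct.assoc k W H H).toLinearMap

@[simp] theorem twist_tmul (W : Type u) [AddCommGroup W] [Module k W] (w : W) (h g : H) :
    twist k H W ((w ⊗ₜ h) ⊗ₜ g) = w ⊗ₜ (antipodeInv k H g * h) := rfl

variable (A : Type u) [Ring A] [Algebra k A]
  (V W X : Type u)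
  [AddCommGroup V] [Module k V] [Module A V] [IsScalarTower k A V] [RightComodule k H V]
  [AddCommGroup W] [Module k W] [Module A W] [IsScalarTower k A W] [RightComodule k H W]
  [AddCommGroup X] [Module k X] [Module A X] [IsScalarTower k A X] [RightComodule k H X]

/-- The map `ρ̃ : Hom_A(V, W) → Hom_k(V, W ⊗ H)`,
`ρ̃(f)(v) = f(v₀)₀ ⊗ S⁻¹(v₁) f(v₀)₁`. -/
noncomputable def rhoTilde : (V →ₗ[A] W) →ₗ[k] (V →ₗ[k] W ⊗[k] H) :=
  (LinearMap.lcomp k (W ⊗[k] H) (rho k H (M := V))) ∘ₗ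
  (LinearMap.llcomp k (V ⊗[k] H) ((W ⊗[k] H) ⊗[k] H) (W ⊗[k] H) (twist k H W)) ∘ₗ
  (LinearMap.rTensorHom H) ∘ₗ
  (LinearMap.llcomp k V W (W ⊗[k] H) (rho k H (M := W))) ∘ₗ
  (LinearMap.restrictScalarsₗ k A V W k)

theorem rhoTilde_apply (f : V →ₗ[A] W) (v : V) :
    rhoTilde k H A V W f v =
      twist k H W ((rho k H (M := W) ∘ₗ f.restrictScalars k).rTensor H (rho k H v)) := rfl

/-- The map `ν : Hom_A(V, W) ⊗ H → Hom_k(V, W ⊗ H)`, `ν(f ⊗ h)(v) = f(v) ⊗ h`. -/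
noncomputable def nu : (V →ₗ[A] W) ⊗[k] H →ₗ[k] (V →ₗ[k] W ⊗[k] H) :=
  TensorProduct.lift
    ((((LinearMap.llcomp k V W (W ⊗[k] H)).flip ∘ₗ LinearMap.restrictScalarsₗ k A V W k).compl₂
      (TensorProduct.mk k W H).flip))

@[simp] theorem nu_tmul (f : V →ₗ[A] W) (h : H) (v : V) :
    nu k H A V W (f ⊗ₜ h) v = f v ⊗ₜ h := rfl

/-- The rational part `HOM_A(V, W)` of `Hom_A(V, W)`: the `A`-linear maps `f` for which there is
`f₀ ⊗ f₁ ∈ Hom_A(V, W) ⊗ H` with `f₀(v) ⊗ f₁ = f(v₀)₀ ⊗ S⁻¹(v₁) f(v₀)₁` for all `v`. -/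
noncomputable def HOM : Submodule k (V →ₗ[A] W) :=
  (LinearMap.range (nu k H A V W)).comap (rhoTilde k H A V W)

theorem mem_HOM (f : V →ₗ[A] W) :
    f ∈ HOM k H A V W ↔ ∃ x, nu k H A V W x = rhoTilde k H A V W f := Iff.rfl


/-- Evaluation `(v, f) ↦ f(v)`. -/
def evalPair : V →ₗ[k] (V →ₗ[A] W) →ₗ[k] W :=
  (LinearMap.restrictScalarsₗ k A V W k).flip

@[simp] theorem evalPair_apply (v : V) (f : V →ₗ[A] W) : evalPair k A V W v f = f v := rfl

theorem rTensor_comp_rho {P : Type u} [AddCommGroup P] [Module k P] (L : V ⊗[k] H →ₗ[k] P)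
    (v : V) : (L ∘ₗ rho k H).rTensor H (rho k H v) =
      L.rTensor H ((TensorProduct.assoc k V H H).symm
        ((Coalgebra.comul (R := k) (A := H)).lTensor V (rho k H v))) := by
  rw [LinearMap.rTensor_comp_apply]
  congr 1
  rw [LinearEquiv.eq_symm_apply]
  exact RightComodule.coassoc v

theorem counit_rho (v : V) : TensorProduct.rid k V
    ((Coalgebra.counit (R := k) (A := H)).lTensor V (rho k H v)) = v :=
  RightComodule.counit v

theorem twist_diag_rho (x : (V →ₗ[A] W) ⊗[k] H) (v : V) :
    twist k H W (((diag k H (evalPair k A V W)).flip x ∘ₗ rho k H).rTensor H (rho k H v)) =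
      nu k H A V W x v := by
  rw [rTensor_comp_rho]
  conv_rhs => rw [← counit_rho k H V v]
  induction rho k H v using TensorProduct.induction_on with
  | zero => simp
  | add a b ha hb => simp only [map_add, ha, hb]
  | tmul w l =>
    induction x using TensorProduct.induction_on with
    | zero => simp
    | add x y hx hy =>
      simp only [map_add, LinearMap.add_apply, LinearMap.rTensor_add, hx, hy]
    | tmul f h =>
      have key : ∀ t : H ⊗[k] H, twist k H W (((diag k H (evalPair k A V W)).flip
          (f ⊗ₜ h)).rTensor H ((TensorProduct.assoc k V H H).symm (w ⊗ₜ t))) =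
            f w ⊗ₜ (mulInvL k H t * h) := by
        intro t
        induction t using TensorProduct.induction_on with
        | zero => simp
        | add a b ha hb => simp only [map_add, TensorProduct.tmul_add, ha, hb, add_mul]
        | tmul a b => simp [mul_assoc]
      rw [LinearMap.lTensor_tmul, key, mulInvL_comul, LinearMap.lTensor_tmul, nu_tmul,
        Algebra.algebraMap_eq_smul_one, smul_mul_assoc, one_mul, TensorProduct.rid_tmul,
        TensorProduct.tmul_smul, TensorProduct.smul_tmul', ← LinearMap.map_smul_of_tower]

/-- `(w ⊗ h) ⊗ g ↦ w ⊗ g h`. -/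
noncomputable def untwist : (W ⊗[k] H) ⊗[k] H →ₗ[k] W ⊗[k] H :=
  (TensorProduct.lift (LinearMap.mul k H).flip).lTensor W ∘ₗ
    (TensorProduct.assoc k W H H).toLinearMap

@[simp] theorem untwist_tmul (w : W) (h g : H) :
    untwist k H W ((w ⊗ₜ h) ⊗ₜ g) = w ⊗ₜ (g * h) := rfl

theorem untwist_nu (x : (V →ₗ[A] W) ⊗[k] H) (t : V ⊗[k] H) :
    untwist k H W ((nu k H A V W x).rTensor H t) = diag k H (evalPair k A V W) t x := by
  induction t using TensorProduct.induction_on with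
  | zero => simp
  | add a b ha hb => simp only [map_add, LinearMap.add_apply, ha, hb]
  | tmul w l =>
    induction x using TensorProduct.induction_on with
    | zero => simp
    | add x y hx hy => simp only [map_add, LinearMap.rTensor_add, LinearMap.add_apply, hx, hy]
    | tmul f h => simp

theorem untwist_rhoTilde (f : V →ₗ[A] W) (v : V) :
    untwist k H W ((rhoTilde k H A V W f).rTensor H (rho k H v)) = rho k H (f v) := by
  have hf : rhoTilde k H A V W f =
      (twist k H W ∘ₗ (rho k H (M := W) ∘ₗ f.restrictScalars k).rTensor H) ∘ₗ rho k H := rfl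
  rw [hf, rTensor_comp_rho]
  conv_rhs => rw [← counit_rho k H V v]
  induction rho k H v using TensorProduct.induction_on with
  | zero => simp
  | add a b ha hb => simp only [map_add, ha, hb]
  | tmul w l =>
    have key : ∀ (s : W ⊗[k] H) (t : H ⊗[k] H), untwist k H W ((twist k H W).rTensor H
        ((TensorProduct.assoc k (W ⊗[k] H) H H).symm (s ⊗ₜ t))) =
          ((LinearMap.mul k H) (mulInvR k H t)).lTensor W s := by
      intro s t
      induction t using TensorProduct.induction_on with
      | zero => simp
      | add a b ha hb =>
        simp only [map_add, TensorProduct.tmul_add, ha, hb, LinearMap.lTensor_add,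
          LinearMap.add_apply]
      | tmul a b =>
        induction s using TensorProduct.induction_on with
        | zero => simp
        | add x y hx hy => simp only [map_add, TensorProduct.add_tmul, hx, hy]
        | tmul x y => simp [mul_assoc]
    have key2 : ∀ t : H ⊗[k] H,
        (twist k H W ∘ₗ (rho k H (M := W) ∘ₗ f.restrictScalars k).rTensor H).rTensor H
          ((TensorProduct.assoc k V H H).symm (w ⊗ₜ t)) = (twist k H W).rTensor H
        ((TensorProduct.assoc k (W ⊗[k] H) H H).symm (rho k H (f w) ⊗ₜ t)) := by
      intro t
      induction t using TensorProduct.induction_on with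
      | zero => simp
      | add a b ha hb => simp only [map_add, TensorProduct.tmul_add, ha, hb]
      | tmul a b => simp
    rw [LinearMap.lTensor_tmul, key2, key, mulInvR_comul, LinearMap.lTensor_tmul,
      TensorProduct.rid_tmul, LinearMap.map_smul_of_tower, map_smul]
    induction rho k H (f w) using TensorProduct.induction_on with
    | zero => simp
    | add x y hx hy => simp only [map_add, smul_add, hx, hy]
    | tmul x y => simp [Algebra.algebraMap_eq_smul_one, TensorProduct.smul_tmul']

/-- `f(v₀)₀ ⊗ S⁻¹(v₁) f(v₀)₁ = f₀(v) ⊗ f₁` is equivalent to `f₀(v₀) ⊗ v₁ f₁ = ρ(f(v))`. -/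
theorem nu_eq_iff (f : V →ₗ[A] W) (x : (V →ₗ[A] W) ⊗[k] H) :
    nu k H A V W x = rhoTilde k H A V W f ↔
      ∀ v, diag k H (evalPair k A V W) (rho k H v) x = rho k H (f v) := by
  constructor
  · intro h v
    rw [← untwist_nu, h, untwist_rhoTilde]
  · intro h
    ext v
    have h' : (diag k H (evalPair k A V W)).flip x ∘ₗ rho k H =
        rho k H (M := W) ∘ₗ f.restrictScalars k := LinearMap.ext h
    rw [← twist_diag_rho, h', rhoTilde_apply]

theorem id_mem_HOM : (LinearMap.id : V →ₗ[A] V) ∈ HOM k H A V V := by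
  refine ⟨LinearMap.id ⊗ₜ 1, (nu_eq_iff k H A V V _ _).2 fun v => ?_⟩
  simp only [LinearMap.id_apply]
  induction rho k H v using TensorProduct.induction_on with
  | zero => simp
  | add x y hx hy => simp only [map_add, LinearMap.add_apply, hx, hy]
  | tmul x h => simp

/-- Composition `(f, g) ↦ g ∘ f` of `A`-linear maps. -/
def compPair : (V →ₗ[A] W) →ₗ[k] (W →ₗ[A] X) →ₗ[k] (V →ₗ[A] X) :=
  LinearMap.mk₂ k (fun f g => g ∘ₗ f) (fun _ _ _ => by ext; simp) (fun _ _ _ => by ext; simp)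
    (fun _ _ _ => by ext; simp) (fun _ _ _ => by ext; simp)

@[simp] theorem compPair_apply (f : V →ₗ[A] W) (g : W →ₗ[A] X) :
    compPair k A V W X f g = g ∘ₗ f := rfl

theorem comp_mem_HOM {f : V →ₗ[A] W} {g : W →ₗ[A] X} (hf : f ∈ HOM k H A V W)
    (hg : g ∈ HOM k H A W X) : g ∘ₗ f ∈ HOM k H A V X := by
  obtain ⟨x, hx⟩ := hf
  obtain ⟨y, hy⟩ := hg
  refine ⟨diag k H (compPair k A V W X) x y, (nu_eq_iff k H A V X _ _).2 fun v => ?_⟩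
  rw [← diag_assoc k H (evalPair k A V W) (evalPair k A W X) (compPair k A V W X)
    (evalPair k A V X) (fun _ _ _ => rfl), (nu_eq_iff k H A V W _ _).1 hx,
    (nu_eq_iff k H A W X _ _).1 hy]
  rfl

variable [Module.Projective k H]

/-- An element of `Y ⊗ H` is recovered from its slices. -/
theorem mem_span_slices {Y : Type u} [AddCommGroup Y] [Module k Y] (x : Y ⊗[k] H) :
    ∃ (I : Finset H) (s : H → H →ₗ[k] k), x = ∑ i ∈ I, slice k H (s i) x ⊗ₜ[k] i := by
  classical
  obtain ⟨s, hs⟩ := Module.projective_def'.1 (inferInstance : Module.Projective k H)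
  have hs' : ∀ h, (s h).sum (fun i c => c • i) = h := fun h => LinearMap.congr_fun hs h
  let φ : H → H →ₗ[k] k := fun i => Finsupp.lapply i ∘ₗ s
  have main : ∃ I : Finset H, ∀ J, I ⊆ J → x = ∑ i ∈ J, slice k H (φ i) x ⊗ₜ[k] i := by
    induction x using TensorProduct.induction_on with
    | zero => exact ⟨∅, fun J _ => by simp⟩
    | add x y hx hy =>
      obtain ⟨I, hI⟩ := hx
      obtain ⟨I', hI'⟩ := hy
      refine ⟨I ∪ I', fun J hJ => ?_⟩
      simp only [map_add, TensorProduct.add_tmul, Finset.sum_add_distrib]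
      rw [← hI J (Finset.union_subset_left hJ), ← hI' J (Finset.union_subset_right hJ)]
    | tmul y h =>
      refine ⟨(s h).support, fun J hJ => ?_⟩
      conv_lhs => rw [← hs' h, Finsupp.sum_of_support_subset _ hJ _ (by simp)]
      rw [TensorProduct.tmul_sum]
      exact Finset.sum_congr rfl fun i _ => by simp [φ, TensorProduct.smul_tmul]
  obtain ⟨I, hI⟩ := main
  exact ⟨I, φ, hI I subset_rfl⟩

theorem slice_nu (φ : H →ₗ[k] k) (x : (V →ₗ[A] W) ⊗[k] H) (v : V) :
    slice k H φ x v = slice k H φ (nu k H A V W x v) := by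
  induction x using TensorProduct.induction_on with
  | zero => simp
  | add x y hx hy => simp only [map_add, LinearMap.add_apply, hx, hy]
  | tmul f h => simp

theorem nu_injective : Function.Injective (nu k H A V W) := by
  refine (injective_iff_map_eq_zero _).2 fun x hx => ?_
  obtain ⟨I, s, hI⟩ := mem_span_slices k H x
  rw [hI]
  refine Finset.sum_eq_zero fun i _ => ?_
  have : slice k H (s i) x = 0 := by
    ext v
    rw [slice_nu, hx]
    simp
  rw [this, TensorProduct.zero_tmul]

theorem twist_comul (l : H) : twist k H H
    ((Coalgebra.comul (R := k) (A := H)).rTensor H (Coalgebra.comul l)) = l ⊗ₜ[k] (1 : H) := by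
  have h1 : mulInvL k H ∘ₗ Coalgebra.comul = Algebra.linearMap k H ∘ₗ Coalgebra.counit :=
    LinearMap.ext fun h => mulInvL_comul k H h
  rw [twist, LinearMap.comp_apply, LinearEquiv.coe_coe, Coalgebra.coassoc_apply,
    ← LinearMap.lTensor_comp_apply, h1, LinearMap.lTensor_comp_apply,
    Coalgebra.lTensor_counit_comul]
  simp

theorem rTensor_rho_twist (z : (W ⊗[k] H) ⊗[k] H) :
    (rho k H (M := W)).rTensor H (twist k H W z) =
      twist k H (W ⊗[k] H) (((rho k H (M := W)).rTensor H).rTensor H z) := by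
  induction z using TensorProduct.induction_on with
  | zero => simp
  | add x y hx hy => simp only [map_add, hx, hy]
  | tmul t g =>
    induction t using TensorProduct.induction_on with
    | zero => simp
    | add x y hx hy => simp only [map_add, TensorProduct.add_tmul, hx, hy]
    | tmul w h => simp

theorem twist_assoc_mul (y : W) (u v : H ⊗[k] H) (b : H) :
    twist k H (W ⊗[k] H) ((TensorProduct.assoc k W H H).symm (y ⊗ₜ[k] (u * v)) ⊗ₜ[k] b) =
      (TensorProduct.assoc k W H H).symm (y ⊗ₜ[k] (twist k H H (u ⊗ₜ[k] b) * v)) := by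
  induction u using TensorProduct.induction_on with
  | zero => simp
  | add x x' hx hx' =>
    simp only [add_mul, TensorProduct.tmul_add, TensorProduct.add_tmul, map_add, hx, hx']
  | tmul a c =>
    induction v using TensorProduct.induction_on with
    | zero => simp
    | add x x' hx hx' =>
      simp only [mul_add, TensorProduct.tmul_add, TensorProduct.add_tmul, map_add, hx, hx']
    | tmul p q => simp [mul_assoc]

theorem slice_assoc_mul (φ : H →ₗ[k] k) (y : W) (l : H) (u : H ⊗[k] H) :
    slice k H φ ((TensorProduct.assoc k W H H).symm (y ⊗ₜ[k] ((l ⊗ₜ[k] (1 : H)) * u))) =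
      y ⊗ₜ[k] (l * slice k H φ u) := by
  induction u using TensorProduct.induction_on with
  | zero => simp
  | add x x' hx hx' => simp only [mul_add, TensorProduct.tmul_add, map_add, hx, hx']
  | tmul p q => simp

theorem slice_twist (φ : H →ₗ[k] k) (x : (V →ₗ[A] W) ⊗[k] H) (t : V ⊗[k] H) :
    slice k H φ (twist k H (W ⊗[k] H)
      (((TensorProduct.assoc k W H H).symm.toLinearMap ∘ₗ
        (Coalgebra.comul (R := k) (A := H)).lTensor W ∘ₗ
          (diag k H (evalPair k A V W)).flip x).rTensor H
        ((TensorProduct.assoc k V H H).symm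
          ((Coalgebra.comul (R := k) (A := H)).lTensor V t)))) =
      diag k H (evalPair k A V W) t
        ((slice k H φ ∘ₗ Coalgebra.comul (R := k) (A := H)).lTensor (V →ₗ[A] W) x) := by
  induction t using TensorProduct.induction_on with
  | zero => simp
  | add a b ha hb => simp only [map_add, LinearMap.add_apply, ha, hb]
  | tmul w l =>
    induction x using TensorProduct.induction_on with
    | zero => simp
    | add a b ha hb =>
      simp only [map_add, LinearMap.comp_add, LinearMap.rTensor_add, LinearMap.add_apply, ha, hb]
    | tmul f h =>
      have key : ∀ s : H ⊗[k] H, twist k H (W ⊗[k] H)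
          (((TensorProduct.assoc k W H H).symm.toLinearMap ∘ₗ
            (Coalgebra.comul (R := k) (A := H)).lTensor W ∘ₗ
              (diag k H (evalPair k A V W)).flip (f ⊗ₜ[k] h)).rTensor H
            ((TensorProduct.assoc k V H H).symm (w ⊗ₜ[k] s))) =
          (TensorProduct.assoc k W H H).symm (f w ⊗ₜ[k] (twist k H H
            ((Coalgebra.comul (R := k) (A := H)).rTensor H s) * Coalgebra.comul h)) := by
        intro s
        induction s using TensorProduct.induction_on with
        | zero => simp
        | add a b ha hb =>
          simp only [map_add, TensorProduct.tmul_add, ha, hb, add_mul]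
        | tmul a b =>
          rw [TensorProduct.assoc_symm_tmul, LinearMap.rTensor_tmul, LinearMap.rTensor_tmul,
            ← twist_assoc_mul, ← Bialgebra.comul_mul]
          simp
      rw [LinearMap.lTensor_tmul, key, twist_comul, slice_assoc_mul, LinearMap.lTensor_tmul,
        diag_tmul]
      rfl

theorem nu_slice (f : V →ₗ[A] W) (x : (V →ₗ[A] W) ⊗[k] H)
    (hx : nu k H A V W x = rhoTilde k H A V W f) (φ : H →ₗ[k] k) :
    nu k H A V W ((slice k H φ ∘ₗ Coalgebra.comul (R := k) (A := H)).lTensor (V →ₗ[A] W) x) =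
      rhoTilde k H A V W (slice k H φ x) := by
  refine (nu_eq_iff k H A V W _ _).2 fun v => ?_
  have hx' := (nu_eq_iff k H A V W f x).1 hx
  have hcomm : ∀ z : W ⊗[k] H, rho k H (slice k H φ z) =
      slice k H φ ((rho k H (M := W)).rTensor H z) := by
    intro z
    induction z using TensorProduct.induction_on with
    | zero => simp
    | add a b ha hb => simp only [map_add, ha, hb]
    | tmul w l => simp
  have hK : (rho k H (M := W)).rTensor H ∘ₗ rho k H (M := W) ∘ₗ f.restrictScalars k =
      ((TensorProduct.assoc k W H H).symm.toLinearMap ∘ₗ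
        (Coalgebra.comul (R := k) (A := H)).lTensor W ∘ₗ
          (diag k H (evalPair k A V W)).flip x) ∘ₗ rho k H := by
    ext v
    simp only [LinearMap.comp_apply, LinearEquiv.coe_coe, LinearMap.flip_apply,
      LinearMap.restrictScalars_apply]
    rw [hx', LinearEquiv.eq_symm_apply]
    exact RightComodule.coassoc (f v)
  rw [slice_nu, hx, hcomm, rhoTilde_apply, rTensor_rho_twist, ← LinearMap.rTensor_comp_apply, hK,
    rTensor_comp_rho, slice_twist]

/-- If `f` is rational with `ρ(f) = f₀ ⊗ f₁`, then the slices of `f₀ ⊗ f₁` are rational. -/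
theorem slice_mem_HOM (f : V →ₗ[A] W) (x : (V →ₗ[A] W) ⊗[k] H)
    (hx : nu k H A V W x = rhoTilde k H A V W f) (φ : H →ₗ[k] k) :
    slice k H φ x ∈ HOM k H A V W :=
  ⟨_, nu_slice k H A V W f x hx φ⟩

/-- The restriction `HOM_A(V, W) ⊗ H → Hom_k(V, W ⊗ H)` of `ν`. -/
noncomputable def nuHOM : HOM k H A V W ⊗[k] H →ₗ[k] (V →ₗ[k] W ⊗[k] H) :=
  nu k H A V W ∘ₗ (HOM k H A V W).subtype.rTensor H

theorem nuHOM_injective : Function.Injective (nuHOM k H A V W) :=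
  (nu_injective k H A V W).comp
    (Module.Flat.rTensor_preserves_injective_linearMap _ (Submodule.subtype_injective _))

theorem mem_range_of_slices {Y : Type u} [AddCommGroup Y] [Module k Y] (P : Submodule k Y)
    (x : Y ⊗[k] H) (hx : ∀ φ : H →ₗ[k] k, slice k H φ x ∈ P) :
    x ∈ LinearMap.range (P.subtype.rTensor H) := by
  obtain ⟨I, s, hI⟩ := mem_span_slices k H x
  rw [hI]
  exact Submodule.sum_mem _ fun i _ => ⟨(⟨_, hx (s i)⟩ : P) ⊗ₜ[k] i, rfl⟩

theorem rhoTilde_mem_range (f : HOM k H A V W) :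
    rhoTilde k H A V W f ∈ LinearMap.range (nuHOM k H A V W) := by
  obtain ⟨x, hx⟩ := f.2
  obtain ⟨y, hy⟩ := mem_range_of_slices k H (HOM k H A V W) x
    (slice_mem_HOM k H A V W f.1 x hx)
  exact ⟨y, by rw [nuHOM, LinearMap.comp_apply, hy, hx]⟩

/-- The coaction `ρ : HOM_A(V, W) → HOM_A(V, W) ⊗ H`, `ρ(f) = f₀ ⊗ f₁`, the unique element with
`f₀(v) ⊗ f₁ = f(v₀)₀ ⊗ S⁻¹(v₁) f(v₀)₁` for all `v`. -/
noncomputable def rhoHOM : HOM k H A V W →ₗ[k] HOM k H A V W ⊗[k] H :=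
  (LinearEquiv.ofInjective (nuHOM k H A V W) (nuHOM_injective k H A V W)).symm.toLinearMap ∘ₗ
    (rhoTilde k H A V W ∘ₗ (HOM k H A V W).subtype).codRestrict
      (LinearMap.range (nuHOM k H A V W)) (rhoTilde_mem_range k H A V W)

theorem nuHOM_rhoHOM (f : HOM k H A V W) :
    nuHOM k H A V W (rhoHOM k H A V W f) = rhoTilde k H A V W f := by
  have := (LinearEquiv.ofInjective (nuHOM k H A V W) (nuHOM_injective k H A V W)).apply_symm_apply
    ((rhoTilde k H A V W ∘ₗ (HOM k H A V W).subtype).codRestrict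
      (LinearMap.range (nuHOM k H A V W)) (rhoTilde_mem_range k H A V W) f)
  exact congrArg Subtype.val this

theorem slice_ext {Y : Type u} [AddCommGroup Y] [Module k Y] {x y : Y ⊗[k] H}
    (h : ∀ φ : H →ₗ[k] k, slice k H φ x = slice k H φ y) : x = y := by
  rw [← sub_eq_zero]
  obtain ⟨I, s, hI⟩ := mem_span_slices k H (x - y)
  rw [hI]
  exact Finset.sum_eq_zero fun i _ => by rw [map_sub, h, sub_self, TensorProduct.zero_tmul]

theorem slice_subtype (φ : H →ₗ[k] k) (x : HOM k H A V W ⊗[k] H) :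
    slice k H φ ((HOM k H A V W).subtype.rTensor H x) = (slice k H φ x).1 := by
  induction x using TensorProduct.induction_on with
  | zero => simp
  | add x y hx hy => simp only [map_add, hx, hy, Submodule.coe_add]
  | tmul f h => simp

theorem rhoHOM_slice (f : HOM k H A V W) (φ : H →ₗ[k] k) :
    rhoHOM k H A V W (slice k H φ (rhoHOM k H A V W f)) =
      (slice k H φ ∘ₗ Coalgebra.comul (R := k) (A := H)).lTensor (HOM k H A V W)
        (rhoHOM k H A V W f) := by
  apply nuHOM_injective
  have h := nu_slice k H A V W f.1 _ (nuHOM_rhoHOM k H A V W f) φ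
  rw [nuHOM_rhoHOM, ← slice_subtype, ← h, nuHOM, LinearMap.comp_apply]
  congr 1
  generalize rhoHOM k H A V W f = x
  induction x using TensorProduct.induction_on with
  | zero => simp
  | add x y hx hy => simp only [map_add, hx, hy]
  | tmul f h => simp

/-- `HOM_A(V, W)` is a right `H`-comodule. -/
noncomputable instance : RightComodule k H (HOM k H A V W) where
  coact := rhoHOM k H A V W
  coassoc f := by
    rw [← LinearEquiv.eq_symm_apply (TensorProduct.assoc k (HOM k H A V W) H H)]
    refine slice_ext (Y := HOM k H A V W ⊗[k] H) k H fun φ => ?_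
    have h1 : ∀ z : HOM k H A V W ⊗[k] H,
        slice k H φ ((rhoHOM k H A V W).rTensor H z) = rhoHOM k H A V W (slice k H φ z) := by
      intro z
      induction z using TensorProduct.induction_on with
      | zero => simp
      | add x y hx hy => simp only [map_add, hx, hy]
      | tmul f h => simp
    have h2 : ∀ z : HOM k H A V W ⊗[k] H, slice k H φ ((TensorProduct.assoc k (HOM k H A V W) H H).symm
        ((Coalgebra.comul (R := k) (A := H)).lTensor (HOM k H A V W) z)) =
          (slice k H φ ∘ₗ Coalgebra.comul (R := k) (A := H)).lTensor (HOM k H A V W) z := by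
      intro z
      induction z using TensorProduct.induction_on with
      | zero => simp
      | add x y hx hy => simp only [map_add, hx, hy]
      | tmul f h =>
        simp only [LinearMap.lTensor_tmul, LinearMap.comp_apply]
        induction (Coalgebra.comul h : H ⊗[k] H) using TensorProduct.induction_on with
        | zero => simp
        | add x y hx hy => simp only [map_add, TensorProduct.tmul_add, hx, hy]
        | tmul a b => simp
    rw [h1, h2, rhoHOM_slice]
  counit f := by
    have h := (nu_eq_iff k H A V W _ _).1 (nuHOM_rhoHOM k H A V W f)
    apply Subtype.ext
    ext v
    have hv := congrArg (slice k H (Coalgebra.counit (R := k) (A := H))) (h v)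
    rw [slice_counit_diag, slice_subtype] at hv
    have e : ∀ {Y : Type u} [AddCommGroup Y] [Module k Y] [RightComodule k H Y] (y : Y),
      slice k H (Coalgebra.counit (R := k) (A := H)) (rho k H y) = y :=
      fun y => RightComodule.counit y
    rw [e, e] at hv
    exact hv

end RationalHom

section Tensor

set_option linter.unusedSectionVars false

variable (k H A B : Type u) [CommRing k] [Ring H] [HopfAlgebra k H]
  [Ring A] [Algebra k A] [Ring B] [Algebra k B]
  (N V W : Type u)
  [AddCommGroup N] [Module k N] [Module Aᵐᵒᵖ N] [IsScalarTower k Aᵐᵒᵖ N]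
  [AddCommGroup V] [Module k V] [Module A V] [IsScalarTower k A V]
  [AddCommGroup W] [Module k W] [Module A W] [IsScalarTower k A W]

/-- The relations `na ⊗ v - n ⊗ av` in `N ⊗ V`. -/
def balRel : Submodule k (N ⊗[k] V) :=
  Submodule.span k {t | ∃ (n : N) (a : A) (v : V),
    t = (MulOpposite.op a • n) ⊗ₜ[k] v - n ⊗ₜ[k] (a • v)}

/-- The tensor product `N ⊗_A V` of a right `A`-module and a left `A`-module. -/
abbrev BalTensor : Type u := (N ⊗[k] V) ⧸ balRel k A N V

/-- The universal balanced map `(n, v) ↦ n ⊗_A v`. -/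
noncomputable def balMk : N →ₗ[k] V →ₗ[k] BalTensor k A N V :=
  (TensorProduct.mk k N V).compr₂ (balRel k A N V).mkQ

theorem balMk_smul (n : N) (a : A) (v : V) :
    balMk k A N V (MulOpposite.op a • n) v = balMk k A N V n (a • v) :=
  (Submodule.Quotient.eq _).2 (Submodule.subset_span ⟨n, a, v, rfl⟩)

theorem bal_ext {P : Type u} [AddCommGroup P] [Module k P] {f g : BalTensor k A N V →ₗ[k] P}
    (h : ∀ n v, f (balMk k A N V n v) = g (balMk k A N V n v)) : f = g := by
  refine Submodule.linearMap_qext _ (TensorProduct.ext' fun n v => h n v)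

/-- A balanced pairing induces a map on `N ⊗_A V`. -/
noncomputable def balLift {P : Type u} [AddCommGroup P] [Module k P] (p : N →ₗ[k] V →ₗ[k] P)
    (hp : ∀ n (a : A) v, p (MulOpposite.op a • n) v = p n (a • v)) :
    BalTensor k A N V →ₗ[k] P :=
  (balRel k A N V).liftQ (TensorProduct.lift p) (Submodule.span_le.2 (by
    rintro _ ⟨n, a, v, rfl⟩
    simp [hp]))

@[simp] theorem balLift_mk {P : Type u} [AddCommGroup P] [Module k P] (p : N →ₗ[k] V →ₗ[k] P)
    (hp : ∀ n (a : A) v, p (MulOpposite.op a • n) v = p n (a • v)) (n : N) (v : V) :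
    balLift k A N V p hp (balMk k A N V n v) = p n v := by
  exact (Submodule.liftQ_apply _ _ _).trans (TensorProduct.lift.tmul _ _)

variable [Module B N] [IsScalarTower k B N] [SMulCommClass B Aᵐᵒᵖ N]

/-- The left `B`-action on `N ⊗_A V`: `b(n ⊗ v) = bn ⊗ v`. -/
noncomputable def balEnd : B →ₐ[k] Module.End k (BalTensor k A N V) :=
  AlgHom.ofLinearMap
    (LinearMap.flip (balLift k A N V
      (P := B →ₗ[k] BalTensor k A N V)
      (LinearMap.mk₂ k (fun n v => (balMk k A N V).flip v ∘ₗ (leftAct k B N).flip n)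
        (fun _ _ _ => by ext; simp) (fun _ _ _ => by ext; simp)
        (fun _ _ _ => by ext; simp) (fun _ _ _ => by ext; simp))
      (fun n a v => by
        ext b
        simp [smul_comm b (MulOpposite.op a) n, balMk_smul])))
    (by
      apply bal_ext
      intro n v
      simp)
    (fun b c => by
      apply bal_ext
      intro n v
      simp [mul_smul])

@[simp] theorem balEnd_mk (b : B) (n : N) (v : V) :
    balEnd k A B N V b (balMk k A N V n v) = balMk k A N V (b • n) v := by
  simp [balEnd]

/-- The compatibility `ρ(av) = a₀v₀ ⊗ a₁v₁` of a left action and a right coaction. -/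
class LeftHopf (k H A V : Type u) [CommRing k] [Ring H] [HopfAlgebra k H] [Ring A] [Algebra k A]
    [ComoduleAlgebra k H A] [AddCommGroup V] [Module k V] [Module A V] [IsScalarTower k A V]
    [RightComodule k H V] : Prop where
  rho_smul : ∀ (a : A) (v : V),
    rho k H (a • v) = diag k H (leftAct k A V) (rho k H a) (rho k H v)

/-- The compatibility `ρ(na) = n₀a₀ ⊗ n₁a₁` of a right action and a right coaction. -/
class RightHopf (k H A N : Type u) [CommRing k] [Ring H] [HopfAlgebra k H] [Ring A] [Algebra k A]
    [ComoduleAlgebra k H A] [AddCommGroup N] [Module k N] [Module Aᵐᵒᵖ N]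
    [IsScalarTower k Aᵐᵒᵖ N] [RightComodule k H N] : Prop where
  rho_smul : ∀ (n : N) (a : A),
    rho k H (MulOpposite.op a • n) = diag k H (rightAct k A N) (rho k H n) (rho k H a)

variable [ComoduleAlgebra k H A] [ComoduleAlgebra k H B] [RightComodule k H N]
  [RightComodule k H V] [RightHopf k H A N] [LeftHopf k H A V]

/-- The coaction `ρ(n ⊗ v) = n₀ ⊗ v₀ ⊗ n₁v₁` on `N ⊗_A V`. -/
noncomputable def rhoBal : BalTensor k A N V →ₗ[k] BalTensor k A N V ⊗[k] H :=
  balLift k A N V ((diag k H (balMk k A N V)).compl₁₂ (rho k H) (rho k H)) (by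
    intro n a v
    simp only [LinearMap.compl₁₂_apply]
    rw [RightHopf.rho_smul, LeftHopf.rho_smul]
    exact diag_assoc k H _ _ _ _ (fun n a v => balMk_smul k A N V n a v) _ _ _)

@[simp] theorem rhoBal_mk (n : N) (v : V) : rhoBal k H A N V (balMk k A N V n v) =
    diag k H (balMk k A N V) (rho k H n) (rho k H v) := by
  simp [rhoBal]

theorem diag_coassoc {P : Type u} [AddCommGroup P] [Module k P] (p : N →ₗ[k] V →ₗ[k] P)
    (r : P →ₗ[k] P ⊗[k] H) (hr : ∀ n v, r (p n v) = diag k H p (rho k H n) (rho k H v))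
    (n : N) (v : V) :
    TensorProduct.assoc k P H H (r.rTensor H (r (p n v))) =
      (Coalgebra.comul (R := k) (A := H)).lTensor P (r (p n v)) := by
  have h1 : ∀ (x : N ⊗[k] H) (y : V ⊗[k] H), r.rTensor H (diag k H p x y) =
      diag k H (diag k H p) ((rho k H).rTensor H x) ((rho k H).rTensor H y) := by
    intro x y
    induction x using TensorProduct.induction_on with
    | zero => simp
    | add x x' hx hx' => simp only [map_add, LinearMap.add_apply, hx, hx']
    | tmul a h =>
      induction y using TensorProduct.induction_on with
      | zero => simp
      | add y y' hy hy' => simp only [map_add, hy, hy']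
      | tmul b g => simp [hr]
  let d2 : N ⊗[k] (H ⊗[k] H) →ₗ[k] V ⊗[k] (H ⊗[k] H) →ₗ[k] P ⊗[k] (H ⊗[k] H) :=
    TensorProduct.map₂ p (LinearMap.mul k (H ⊗[k] H))
  have h2 : ∀ (x : (N ⊗[k] H) ⊗[k] H) (y : (V ⊗[k] H) ⊗[k] H),
      TensorProduct.assoc k P H H (diag k H (diag k H p) x y) =
        d2 (TensorProduct.assoc k N H H x) (TensorProduct.assoc k V H H y) := by
    intro x y
    induction x using TensorProduct.induction_on with
    | zero => simp
    | add x x' hx hx' => simp only [map_add, LinearMap.add_apply, hx, hx']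
    | tmul a h =>
      induction a using TensorProduct.induction_on with
      | zero => simp
      | add x x' hx hx' => simp only [map_add, TensorProduct.add_tmul, LinearMap.add_apply, hx, hx']
      | tmul a h' =>
        induction y using TensorProduct.induction_on with
        | zero => simp
        | add y y' hy hy' => simp only [map_add, hy, hy']
        | tmul b g =>
          induction b using TensorProduct.induction_on with
          | zero => simp
          | add y y' hy hy' => simp only [map_add, TensorProduct.add_tmul, hy, hy']
          | tmul b g' => simp [d2]
  have h3 : ∀ (x : N ⊗[k] H) (y : V ⊗[k] H),
      (Coalgebra.comul (R := k) (A := H)).lTensor P (diag k H p x y) =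
        d2 ((Coalgebra.comul (R := k) (A := H)).lTensor N x)
          ((Coalgebra.comul (R := k) (A := H)).lTensor V y) := by
    intro x y
    induction x using TensorProduct.induction_on with
    | zero => simp
    | add x x' hx hx' => simp only [map_add, LinearMap.add_apply, hx, hx']
    | tmul a h =>
      induction y using TensorProduct.induction_on with
      | zero => simp
      | add y y' hy hy' => simp only [map_add, hy, hy']
      | tmul b g => simp [d2]
  have hn : TensorProduct.assoc k N H H ((rho k H).rTensor H (rho k H n)) =
      (Coalgebra.comul (R := k) (A := H)).lTensor N (rho k H n) := RightComodule.coassoc n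
  have hv : TensorProduct.assoc k V H H ((rho k H).rTensor H (rho k H v)) =
      (Coalgebra.comul (R := k) (A := H)).lTensor V (rho k H v) := RightComodule.coassoc v
  rw [hr, h1, h2, h3, hn, hv]

noncomputable instance : RightComodule k H (BalTensor k A N V) where
  coact := rhoBal k H A N V
  coassoc x := by
    refine LinearMap.congr_fun (f := (TensorProduct.assoc k (BalTensor k A N V) H H).toLinearMap ∘ₗ
      (rhoBal k H A N V).rTensor H ∘ₗ rhoBal k H A N V)
      (g := (Coalgebra.comul (R := k) (A := H)).lTensor (BalTensor k A N V) ∘ₗ rhoBal k H A N V)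
      (bal_ext k A N V fun n v => ?_) x
    exact diag_coassoc k H N V (balMk k A N V) (rhoBal k H A N V) (rhoBal_mk k H A N V) n v
  counit x := by
    refine LinearMap.congr_fun
      (f := slice k H (Coalgebra.counit (R := k) (A := H)) ∘ₗ rhoBal k H A N V)
      (g := LinearMap.id) (bal_ext k A N V fun n v => ?_) x
    rw [LinearMap.comp_apply, rhoBal_mk, slice_counit_diag]
    exact congrArg₂ (fun n v => balMk k A N V n v) (RightComodule.counit n)
      (RightComodule.counit v)

theorem rho_bal (n : N) (v : V) : rho k H (balMk k A N V n v) =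
    diag k H (balMk k A N V) (rho k H n) (rho k H v) :=
  rhoBal_mk k H A N V n v

end Tensor
section Categories

/-- A relative Hopf module: a left `A`-module and right `H`-comodule `V` with
`ρ(av) = a₀v₀ ⊗ a₁v₁`. -/
structure HopfMod (k H A : Type u) [CommRing k] [Ring H] [HopfAlgebra k H] [Ring A] [Algebra k A]
    [ComoduleAlgebra k H A] where
  carrier : Type u
  [addCommGroup : AddCommGroup carrier]
  [moduleBase : Module k carrier]
  [moduleLeft : Module A carrier]
  [towerLeft : IsScalarTower k A carrier]
  [comodule : RightComodule k H carrier]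
  [leftHopf : LeftHopf k H A carrier]

attribute [instance] HopfMod.addCommGroup HopfMod.moduleBase HopfMod.moduleLeft
  HopfMod.towerLeft HopfMod.comodule HopfMod.leftHopf

/-- A two-sided relative Hopf module: an `(A, B)`-bimodule and right `H`-comodule `M` with
`ρ(amb) = a₀m₀b₀ ⊗ a₁m₁b₁`. -/
structure HopfBimod (k H A B : Type u) [CommRing k] [Ring H] [HopfAlgebra k H]
    [Ring A] [Algebra k A] [ComoduleAlgebra k H A] [Ring B] [Algebra k B] [ComoduleAlgebra k H B]
    extends HopfMod k H A where
  [moduleRight : Module Bᵐᵒᵖ carrier]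
  [towerRight : IsScalarTower k Bᵐᵒᵖ carrier]
  [comm : SMulCommClass A Bᵐᵒᵖ carrier]
  [rightHopf : RightHopf k H B carrier]

attribute [instance] HopfBimod.moduleRight HopfBimod.towerRight HopfBimod.comm
  HopfBimod.rightHopf

variable {k H A B : Type u} [CommRing k] [Ring H] [HopfAlgebra k H]
  [Ring A] [Algebra k A] [ComoduleAlgebra k H A] [Ring B] [Algebra k B] [ComoduleAlgebra k H B]

/-- The relative Hopf module `N ⊗_A V` with `b(n ⊗ v) = bn ⊗ v` and
`ρ(n ⊗ v) = n₀ ⊗ v₀ ⊗ n₁v₁`. -/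
noncomputable def tensorObj (N : HopfBimod k H B A) (V : HopfMod k H A) : HopfMod k H B :=
  letI : Module B (BalTensor k A N.carrier V.carrier) :=
    Module.compHom _ (balEnd k A B N.carrier V.carrier).toRingHom
  haveI tower : IsScalarTower k B (BalTensor k A N.carrier V.carrier) :=
    ⟨fun c b x => by
      change balEnd k A B N.carrier V.carrier (c • b) x =
        c • balEnd k A B N.carrier V.carrier b x
      rw [map_smul]
      rfl⟩
  { carrier := BalTensor k A N.carrier V.carrier
    towerLeft := tower
    leftHopf := ⟨fun b x => by
      refine LinearMap.congr_fun
        (f := rho k H ∘ₗ leftAct k B (BalTensor k A N.carrier V.carrier) b)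
        (g := diag k H (leftAct k B (BalTensor k A N.carrier V.carrier)) (rho k H b) ∘ₗ rho k H)
        (bal_ext k A N.carrier V.carrier fun n v => ?_) x
      have h1 : ∀ (b : B) (n : N.carrier) (v : V.carrier),
          leftAct k B (BalTensor k A N.carrier V.carrier) b
            (balMk k A N.carrier V.carrier n v) = balMk k A N.carrier V.carrier (b • n) v :=
        fun b n v => balEnd_mk k A B N.carrier V.carrier b n v
      rw [LinearMap.comp_apply, LinearMap.comp_apply, h1, rho_bal, rho_bal, LeftHopf.rho_smul]
      exact diag_assoc k H _ _ _ _ (fun b n v => (h1 b n v).symm) _ _ _⟩ }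

/-- The element `n ⊗_A v` of `N ⊗_A V`. -/
noncomputable def tmk (N : HopfBimod k H B A) (V : HopfMod k H A) :
    N.carrier →ₗ[k] V.carrier →ₗ[k] (tensorObj N V).carrier :=
  balMk k A N.carrier V.carrier

theorem smul_tmk (N : HopfBimod k H B A) (V : HopfMod k H A) (b : B) (n : N.carrier)
    (v : V.carrier) : b • tmk N V n v = tmk N V (b • n) v :=
  balEnd_mk k A B N.carrier V.carrier b n v

theorem rho_tmk (N : HopfBimod k H B A) (V : HopfMod k H A) (n : N.carrier)
    (v : V.carrier) : rho k H (tmk N V n v) = diag k H (tmk N V) (rho k H n) (rho k H v) :=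
  rho_bal k H A N.carrier V.carrier n v

theorem tensor_ext (N : HopfBimod k H B A) (V : HopfMod k H A) {P : Type u} [AddCommGroup P]
    [Module k P] {f g : (tensorObj N V).carrier →ₗ[k] P}
    (h : ∀ n v, f (tmk N V n v) = g (tmk N V n v)) : f = g :=
  bal_ext k A N.carrier V.carrier h

/-- The map `N ⊗_A f : N ⊗_A V → N ⊗_A W`, `n ⊗ v ↦ n ⊗ f(v)`. -/
noncomputable def tensorMapAux (N : HopfBimod k H B A) {V W : HopfMod k H A}
    (f : V.carrier →ₗ[A] W.carrier) : (tensorObj N V).carrier →ₗ[k] (tensorObj N W).carrier :=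
  balLift k A N.carrier V.carrier ((tmk N W).compl₂ (f.restrictScalars k)) (fun n a v => by
    simp only [LinearMap.compl₂_apply, LinearMap.restrictScalars_apply, map_smul]
    exact balMk_smul k A N.carrier W.carrier n a (f v))

theorem tensorMapAux_tmk (N : HopfBimod k H B A) {V W : HopfMod k H A}
    (f : V.carrier →ₗ[A] W.carrier) (n : N.carrier) (v : V.carrier) :
    tensorMapAux N f (tmk N V n v) = tmk N W n (f v) :=
  balLift_mk k A N.carrier V.carrier _ _ n v

/-- The map `f ↦ N ⊗_A f` from `A`-linear to `B`-linear maps. -/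
noncomputable def tensorMap (N : HopfBimod k H B A) (V W : HopfMod k H A) :
    (V.carrier →ₗ[A] W.carrier) →ₗ[k]
      ((tensorObj N V).carrier →ₗ[B] (tensorObj N W).carrier) where
  toFun f :=
    { toFun := tensorMapAux N f
      map_add' := map_add _
      map_smul' := fun b x => by
        refine LinearMap.congr_fun (f := tensorMapAux N f ∘ₗ leftAct k B _ b)
          (g := leftAct k B _ b ∘ₗ tensorMapAux N f) (tensor_ext N V fun n v => ?_) x
        simp only [LinearMap.comp_apply, leftAct_apply, smul_tmk, tensorMapAux_tmk] }
  map_add' f g := by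
    refine LinearMap.ext fun x => LinearMap.congr_fun (f := tensorMapAux N (f + g))
      (g := tensorMapAux N f + tensorMapAux N g) (tensor_ext N V fun n v => ?_) x
    simp only [LinearMap.add_apply, tensorMapAux_tmk, map_add]
  map_smul' c f := by
    refine LinearMap.ext fun x => LinearMap.congr_fun (f := tensorMapAux N (c • f))
      (g := c • tensorMapAux N f) (tensor_ext N V fun n v => ?_) x
    simp only [LinearMap.smul_apply, tensorMapAux_tmk, map_smul]

theorem tensorMap_tmk (N : HopfBimod k H B A) (V W : HopfMod k H A)
    (f : V.carrier →ₗ[A] W.carrier) (n : N.carrier) (v : V.carrier) :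
    tensorMap N V W f (tmk N V n v) = tmk N W n (f v) :=
  tensorMapAux_tmk N f n v

variable [HasBijectiveAntipode k H]

theorem tensorMap_mem_HOM (N : HopfBimod k H B A) (V W : HopfMod k H A)
    {f : V.carrier →ₗ[A] W.carrier} (hf : f ∈ HOM k H A V.carrier W.carrier) :
    tensorMap N V W f ∈ HOM k H B (tensorObj N V).carrier (tensorObj N W).carrier := by
  obtain ⟨x, hx⟩ := hf
  have hx := (nu_eq_iff k H A V.carrier W.carrier f x).1 hx
  refine ⟨(tensorMap N V W).rTensor H x, (nu_eq_iff k H B _ _ _ _).2 fun t => ?_⟩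
  rw [diag_rTensor]
  refine LinearMap.congr_fun (f := (diag k H ((evalPair k B (tensorObj N V).carrier
      (tensorObj N W).carrier).compl₂ (tensorMap N V W))).flip x ∘ₗ rho k H)
    (g := rho k H ∘ₗ (tensorMap N V W f).restrictScalars k) (tensor_ext N V fun n v => ?_) t
  simp only [LinearMap.comp_apply, LinearMap.flip_apply, LinearMap.restrictScalars_apply,
    rho_tmk, tensorMap_tmk, ← hx]
  exact diag_assoc k H _ _ _ _ (fun n v g => tensorMap_tmk N V W g n v) _ _ _

/-- The category `_A M^H` of relative Hopf modules with the rational parts `HOM_A(V, W)` as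
morphisms. -/
noncomputable instance : Category (HopfMod k H A) where
  Hom V W := HOM k H A V.carrier W.carrier
  id V := ⟨LinearMap.id, id_mem_HOM k H A V.carrier⟩
  comp f g := ⟨g.1 ∘ₗ f.1, comp_mem_HOM k H A _ _ _ f.2 g.2⟩

/-- The `A`-linear map underlying a morphism. -/
def toLin {V W : HopfMod k H A} (f : V ⟶ W) : V.carrier →ₗ[A] W.carrier :=
  Subtype.val (p := fun g => g ∈ HOM k H A V.carrier W.carrier) f

/-- The functor `N ⊗_A -`. -/
noncomputable def tensorFunctor (N : HopfBimod k H B A) : HopfMod k H A ⥤ HopfMod k H B where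
  obj V := tensorObj N V
  map {V W} f := ⟨tensorMap N V W (toLin f), tensorMap_mem_HOM N V W f.2⟩
  map_id V := by
    refine Subtype.ext (LinearMap.ext fun x => LinearMap.congr_fun
      (f := (tensorMap N V V LinearMap.id).restrictScalars k) (g := LinearMap.id)
      (tensor_ext N V fun n v => ?_) x)
    exact tensorMap_tmk N V V _ n v
  map_comp {V W X} f g := by
    refine Subtype.ext (LinearMap.ext fun x => LinearMap.congr_fun
      (f := (tensorMap N V X (toLin g ∘ₗ toLin f)).restrictScalars k)
      (g := (tensorMap N W X (toLin g)).restrictScalars k ∘ₗ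
        (tensorMap N V W (toLin f)).restrictScalars k)
      (tensor_ext N V fun n v => ?_) x)
    simp only [LinearMap.comp_apply, LinearMap.restrictScalars_apply, tensorMap_tmk]

/-- The functors `F, G` are isomorphic: there is a natural isomorphism whose components are right
`H`-colinear, i.e. morphisms of relative Hopf modules. -/
def ColinearIso (F G : HopfMod k H A ⥤ HopfMod k H B) : Prop :=
  ∃ η : F ≅ G, ∀ V, Colinear k H ((toLin (η.hom.app V)).restrictScalars k)

/-- A functor `F` is right `H`-colinear: all maps `F : HOM_A(V, W) → HOM_B(F(V), F(W))` are
morphisms of right `H`-comodules. -/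
def ColinearFunctor [Module.Projective k H] (F : HopfMod k H A ⥤ HopfMod k H B) : Prop :=
  ∀ V W : HopfMod k H A,
    ∃ L : HOM k H A V.carrier W.carrier →ₗ[k] HOM k H B (F.obj V).carrier (F.obj W).carrier,
      (∀ f : V ⟶ W, L f = F.map f) ∧ Colinear k H L

/-- An `H`-Morita context `(A, B, M, N, α, β)`. -/
structure MoritaContext (k H A B : Type u) [CommRing k] [Ring H] [HopfAlgebra k H]
    [Ring A] [Algebra k A] [ComoduleAlgebra k H A]
    [Ring B] [Algebra k B] [ComoduleAlgebra k H B] where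
  M : HopfBimod k H A B
  N : HopfBimod k H B A
  /-- the map `α : M ⊗_B N → A` -/
  α : (tensorObj M N.toHopfMod).carrier →ₗ[A] A
  /-- the map `β : N ⊗_A M → B` -/
  β : (tensorObj N M.toHopfMod).carrier →ₗ[B] B
  α_right : ∀ (m : M.carrier) (n : N.carrier) (a : A),
    α (tmk M N.toHopfMod m (MulOpposite.op a • n)) = α (tmk M N.toHopfMod m n) * a
  β_right : ∀ (n : N.carrier) (m : M.carrier) (b : B),
    β (tmk N M.toHopfMod n (MulOpposite.op b • m)) = β (tmk N M.toHopfMod n m) * b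
  α_colinear : Colinear k H (α.restrictScalars k)
  β_colinear : Colinear k H (β.restrictScalars k)
  α_smul : ∀ (m : M.carrier) (n : N.carrier) (m' : M.carrier),
    α (tmk M N.toHopfMod m n) • m' = MulOpposite.op (β (tmk N M.toHopfMod n m')) • m
  β_smul : ∀ (n : N.carrier) (m : M.carrier) (n' : N.carrier),
    β (tmk N M.toHopfMod n m) • n' = MulOpposite.op (α (tmk M N.toHopfMod m n')) • n

/-- The Morita context is strict: `α` and `β` are isomorphisms. -/
def MoritaContext.IsStrict (C : MoritaContext k H A B) : Prop :=
  Function.Bijective C.α ∧ Function.Bijective C.β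

end Categories
end HopfMorita

/-! This is an Eilenberg–Watts argument in which colinearity takes the place of exactness. Put `N =
T(A)`. Right multiplication by `a ∈ A` is usually not colinear, but it does lie in `HOM_A(A, A)`. So
`T` can be applied to it, which makes `N` a right `A`-module. More generally each `v ∈ V` gives the
morphism `a ↦ av` in `HOM_A(A, V)`, and `(n, v) ↦ T(a ↦ av)(n)` is a balanced pairing `N × V →
T(V)`. It respects coactions because `V → HOM_A(A, V)` and `T` on HOM are both colinear
(`rho_pairing`). The result is a colinear natural transformation `N ⊗_A - → T` (`compareNat`).

It is invertible for formal reasons. Faithfulness, fullness and essential surjectivity of `T` make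
each component epi (`epi_compareNat`). In the other direction, a colinear `B`-map `g : N ⊗_A V →
T(Y)` curries to a colinear map `V → HOM_B(T(A), T(Y)) ≅ HOM_A(A, Y) ≅ Y`, so `g` factors through
the comparison (`exists_compareNat_comp`). Taking for `g` a colinear isomorphism with `Y = U(N ⊗_A
V)`, supplied by `T ∘ U ≅ Id`, shows that the comparison is split mono, hence an isomorphism.

The same applies to `U`, with `M = U(B)`. The context maps are `α : M ⊗_B N ≅ U(T(A)) ≅ A` and `β :
N ⊗_A M ≅ T(U(B)) ≅ B`. Their compatibility is the pair of triangle identities, so the isomorphism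
onto `B` has to be matched to the one onto `A`; an arbitrary isomorphism `T ∘ U ≅ Id` would not do.
-/

namespace HopfMorita

/-! ### Diagonal coactions, colinear maps and the coaction on HOM. -/

noncomputable section Pairings

set_option linter.unusedSectionVars false

variable {k H A B : Type u} [CommRing k] [Ring H] [HopfAlgebra k H]

theorem diag_tmul_one {X Y Z : Type u} [AddCommGroup X] [Module k X] [AddCommGroup Y]
    [Module k Y] [AddCommGroup Z] [Module k Z] (p : X →ₗ[k] Y →ₗ[k] Z) (x : X)
    (y : Y ⊗[k] H) : diag k H p (x ⊗ₜ 1) y = (p x).rTensor H y := by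
  induction y using TensorProduct.induction_on with
  | zero => simp
  | add y y' hy hy' => simp only [map_add, hy, hy']
  | tmul b g => simp

theorem diag_flip_tmul_one {X Y Z : Type u} [AddCommGroup X] [Module k X] [AddCommGroup Y]
    [Module k Y] [AddCommGroup Z] [Module k Z] (p : X →ₗ[k] Y →ₗ[k] Z) (y : Y)
    (x : X ⊗[k] H) : diag k H p x (y ⊗ₜ 1) = (p.flip y).rTensor H x := by
  induction x using TensorProduct.induction_on with
  | zero => simp
  | add y y' hy hy' => simp only [map_add, LinearMap.add_apply, hy, hy']
  | tmul b g => simp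

theorem rTensor_diag {X Y Z Z' : Type u} [AddCommGroup X] [Module k X] [AddCommGroup Y]
    [Module k Y] [AddCommGroup Z] [Module k Z] [AddCommGroup Z'] [Module k Z']
    (p : X →ₗ[k] Y →ₗ[k] Z) (L : Z →ₗ[k] Z') (x : X ⊗[k] H) (y : Y ⊗[k] H) :
    L.rTensor H (diag k H p x y) = diag k H (p.compr₂ L) x y := by
  induction x using TensorProduct.induction_on with
  | zero => simp
  | add x x' hx hx' => simp only [map_add, LinearMap.add_apply, hx, hx']
  | tmul a h =>
    induction y using TensorProduct.induction_on with
    | zero => simp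
    | add y y' hy hy' => simp only [map_add, hy, hy']
    | tmul b g => simp

theorem Colinear.comp {X Y Z : Type u} [AddCommGroup X] [Module k X] [RightComodule k H X]
    [AddCommGroup Y] [Module k Y] [RightComodule k H Y]
    [AddCommGroup Z] [Module k Z] [RightComodule k H Z] {g : Y →ₗ[k] Z} {f : X →ₗ[k] Y}
    (hg : Colinear k H g) (hf : Colinear k H f) : Colinear k H (g ∘ₗ f) := fun x => by
  rw [LinearMap.comp_apply, hg, hf, LinearMap.rTensor_comp_apply]

theorem Colinear.of_leftInverse {X Y : Type u} [AddCommGroup X] [Module k X] [RightComodule k H X]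
    [AddCommGroup Y] [Module k Y] [RightComodule k H Y] {f : X →ₗ[k] Y} {g : Y →ₗ[k] X}
    (hf : Colinear k H f) (hgf : ∀ x, g (f x) = x) (hfg : ∀ y, f (g y) = y) :
    Colinear k H g := fun y => by
  have h : g ∘ₗ f = LinearMap.id := LinearMap.ext hgf
  conv_rhs => rw [← hfg y, hf, ← LinearMap.rTensor_comp_apply, h, LinearMap.rTensor_id_apply]

variable [Ring A] [Algebra k A] [ComoduleAlgebra k H A]

instance : LeftHopf k H A A := ⟨ComoduleAlgebra.coact_mul⟩

variable (k H A) in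
/-- `A` as a relative Hopf module over itself. -/
abbrev regular : HopfMod k H A := { carrier := A }

variable [HasBijectiveAntipode k H]

@[simp] theorem toLin_comp {V W X : HopfMod k H A} (f : V ⟶ W) (g : W ⟶ X) (v : V.carrier) :
    toLin (f ≫ g) v = toLin g (toLin f v) := rfl

@[simp] theorem toLin_id {V : HopfMod k H A} (v : V.carrier) : toLin (𝟙 V) v = v := rfl

theorem hom_ext {V W : HopfMod k H A} {f g : V ⟶ W} (h : ∀ v, toLin f v = toLin g v) : f = g :=
  Subtype.ext (LinearMap.ext h)

variable [Module.Projective k H]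

/-- A morphism as an element of the comodule `HOM_A(V, W)`. -/
abbrev asHOM {V W : HopfMod k H A} (f : V ⟶ W) : HOM k H A V.carrier W.carrier := f

/-- The evaluation pairing `V × HOM_A(V, W) → W`. -/
def evalHOM (V W : HopfMod k H A) :
    V.carrier →ₗ[k] HOM k H A V.carrier W.carrier →ₗ[k] W.carrier :=
  (evalPair k A V.carrier W.carrier).compl₂ (HOM k H A V.carrier W.carrier).subtype

/-- The coaction on `HOM_A(V, W)` is characterised by `ρ(f(v)) = f₀(v₀) ⊗ v₁ f₁`. -/
theorem rho_eq_iff {V W : HopfMod k H A} (f : HOM k H A V.carrier W.carrier)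
    (x : HOM k H A V.carrier W.carrier ⊗[k] H) :
    rho k H f = x ↔ ∀ v : V.carrier, diag k H (evalHOM V W) (rho k H v) x = rho k H (f.1 v) := by
  have h1 : rho k H f = x ↔ nuHOM k H A V.carrier W.carrier x =
      rhoTilde k H A V.carrier W.carrier f.1 := by
    rw [← nuHOM_rhoHOM]
    exact ⟨fun h => by rw [← h]; rfl, fun h => (nuHOM_injective k H A _ _ h).symm⟩
  rw [h1, nuHOM, LinearMap.comp_apply, nu_eq_iff]
  simp only [diag_rTensor]
  rfl

theorem rho_toLin {V W : HopfMod k H A} (f : V ⟶ W) (v : V.carrier) :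
    rho k H (toLin f v) = diag k H (evalHOM V W) (rho k H v)
      (rho k H (asHOM f)) :=
  ((rho_eq_iff (V := V) (W := W) f _).1 rfl v).symm

/-- Colinear morphisms are the coinvariants of the comodule HOM: for `x = f ⊗ 1` the
characterisation `rho_eq_iff` is literally colinearity of `f`. A comodule map between HOMs therefore
carries colinear morphisms to colinear ones. -/
theorem colinear_iff {V W : HopfMod k H A} (f : V ⟶ W) :
    Colinear k H ((toLin f).restrictScalars k) ↔
      rho k H (asHOM f) = asHOM f ⊗ₜ 1 := by
  rw [rho_eq_iff]
  refine forall_congr' fun v => ?_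
  rw [diag_flip_tmul_one]
  exact eq_comm

/-- The map `W → HOM_A(V, P)`, `w ↦ p(-, w)` induced by an `A`-linear colinear pairing
`V ⊗ W → P`. -/
def curryHOM {V P : HopfMod k H A} {W : Type u} [AddCommGroup W] [Module k W]
    [RightComodule k H W] (p : V.carrier →ₗ[k] W →ₗ[k] P.carrier)
    (hp : ∀ (a : A) v w, p (a • v) w = a • p v w)
    (hr : ∀ v w, rho k H (p v w) = diag k H p (rho k H v) (rho k H w)) :
    W →ₗ[k] HOM k H A V.carrier P.carrier :=
  let c : W →ₗ[k] V.carrier →ₗ[A] P.carrier :=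
    { toFun w := { p.flip w with map_smul' := fun a v => hp a v w }
      map_add' x y := LinearMap.ext fun v => map_add (p v) x y
      map_smul' x y := LinearMap.ext fun v => map_smul (p v) x y }
  -- The witness of rationality is `p(-, w₀) ⊗ w₁`. The order `v₁w₁` in the diagonal coaction agrees
  -- with `v₁f₁` in `nu_eq_iff`, so no antipode appears.
  c.codRestrict _ fun w => ⟨c.rTensor H (rho k H w), (nu_eq_iff k H A _ _ _ _).2 fun v => by
    rw [diag_rTensor]
    exact (hr v w).symm⟩

/-- The element that witnesses rationality in `curryHOM` is the image of `ρ(w)`, and the coaction on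
HOM is determined by such a witness. -/
theorem colinear_curryHOM {V P : HopfMod k H A} {W : Type u} [AddCommGroup W] [Module k W]
    [RightComodule k H W] (p : V.carrier →ₗ[k] W →ₗ[k] P.carrier)
    (hp : ∀ (a : A) v w, p (a • v) w = a • p v w)
    (hr : ∀ v w, rho k H (p v w) = diag k H p (rho k H v) (rho k H w)) :
    Colinear k H (curryHOM p hp hr) := fun w => by
  rw [rho_eq_iff]
  intro v
  rw [diag_rTensor]
  exact (hr v w).symm

/-- A colinear `A`-linear map as a morphism. -/
def ofColinear {V W : HopfMod k H A} (f : V.carrier →ₗ[A] W.carrier)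
    (hf : Colinear k H (f.restrictScalars k)) : V ⟶ W :=
  ⟨f, f ⊗ₜ 1, (nu_eq_iff k H A _ _ _ _).2 fun v => by
    rw [diag_flip_tmul_one]
    exact (hf v).symm⟩

theorem colinear_inv {V W : HopfMod k H A} (e : V ≅ W)
    (he : Colinear k H ((toLin e.hom).restrictScalars k)) :
    Colinear k H ((toLin e.inv).restrictScalars k) :=
  he.of_leftInverse
    (fun x => by
      change toLin e.inv (toLin e.hom x) = x
      rw [← toLin_comp, e.hom_inv_id, toLin_id])
    (fun x => by
      change toLin e.hom (toLin e.inv x) = x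
      rw [← toLin_comp, e.inv_hom_id, toLin_id])

theorem bijective_toLin {V W : HopfMod k H A} (f : V ⟶ W) [IsIso f] :
    Function.Bijective (toLin f) :=
  Function.bijective_iff_has_inverse.2 ⟨toLin (inv f),
    fun x => by rw [← toLin_comp, IsIso.hom_inv_id, toLin_id],
    fun x => by rw [← toLin_comp, IsIso.inv_hom_id, toLin_id]⟩

/-! ### Morphisms out of the regular module. -/

/-- The map `V → HOM_A(A, V)`, `v ↦ (a ↦ av)`. -/
def pointHOM (V : HopfMod k H A) : V.carrier →ₗ[k] HOM k H A (regular k H A).carrier V.carrier :=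
  curryHOM (V := regular k H A) (leftAct k A V.carrier) (fun a b v => mul_smul a b v)
    LeftHopf.rho_smul

theorem colinear_pointHOM (V : HopfMod k H A) : Colinear k H (pointHOM V) :=
  colinear_curryHOM _ _ _

/-- The morphism `A → V`, `a ↦ av`. -/
def point {V : HopfMod k H A} (v : V.carrier) : regular k H A ⟶ V := pointHOM V v

@[simp] theorem toLin_point {V : HopfMod k H A} (v : V.carrier) (a : A) :
    toLin (point v) a = a • v := rfl

theorem point_comp {V W : HopfMod k H A} (v : V.carrier) (f : V ⟶ W) :
    point v ≫ f = point (toLin f v) :=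
  hom_ext fun a => by
    rw [toLin_comp]
    exact map_smul (toLin f) a v

theorem point_one : point (V := regular k H A) (1 : A) = 𝟙 _ :=
  hom_ext fun a => mul_one (a : A)

/-- `A` is free on `1` and every map `a ↦ av` is rational, so `HOM_A(A, V)` is all of `V`. This lets
elements be treated as morphisms, to which functors apply. -/
theorem eq_point {V : HopfMod k H A} (f : regular k H A ⟶ V) : f = point (toLin f (1 : A)) := by
  rw [← point_comp, point_one, Category.id_comp]

theorem point_injective {V : HopfMod k H A} {v w : V.carrier} (h : point v = point w) :
    v = w := by
  rw [← one_smul A v, ← one_smul A w, ← toLin_point, ← toLin_point, h]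

end Pairings

/-! ### Colinear functors and their effect on HOM comodules. -/

noncomputable section ColinearFunctors

set_option linter.unusedSectionVars false

variable {k H A B : Type u} [CommRing k] [Ring H] [HopfAlgebra k H]
  [Ring A] [Algebra k A] [ComoduleAlgebra k H A] [Ring B] [Algebra k B] [ComoduleAlgebra k H B]
  [HasBijectiveAntipode k H] [Module.Projective k H]
  {F : HopfMod k H A ⥤ HopfMod k H B} (hF : ColinearFunctor F)

namespace ColinearFunctor

/-- The `k`-linear map `HOM_A(V, W) → HOM_B(F(V), F(W))`. -/
def lin (V W : HopfMod k H A) :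
    HOM k H A V.carrier W.carrier →ₗ[k] HOM k H B (F.obj V).carrier (F.obj W).carrier :=
  (hF V W).choose

theorem lin_apply {V W : HopfMod k H A} (f : V ⟶ W) : hF.lin V W (asHOM f) = F.map f :=
  (hF V W).choose_spec.1 f

theorem colinear_lin (V W : HopfMod k H A) : Colinear k H (hF.lin V W) :=
  (hF V W).choose_spec.2

theorem lin_bijective [F.Full] [F.Faithful] (V W : HopfMod k H A) :
    Function.Bijective (hF.lin V W) := by
  have h : ⇑(hF.lin V W) = fun f : V ⟶ W => F.map f := funext fun f => hF.lin_apply f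
  rw [h]
  exact ⟨F.map_injective, F.map_surjective⟩

/-- A fully faithful colinear functor induces isomorphisms `HOM_A(V, W) ≃ HOM_B(F(V), F(W))`. -/
def linEquiv [F.Full] [F.Faithful] (V W : HopfMod k H A) :
    HOM k H A V.carrier W.carrier ≃ₗ[k] HOM k H B (F.obj V).carrier (F.obj W).carrier :=
  LinearEquiv.ofBijective (hF.lin V W) (hF.lin_bijective V W)

theorem colinear_linEquiv_symm [F.Full] [F.Faithful] (V W : HopfMod k H A) :
    Colinear k H (hF.linEquiv V W).symm.toLinearMap :=
  (hF.colinear_lin V W).of_leftInverse (hF.linEquiv V W).symm_apply_apply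
    (hF.linEquiv V W).apply_symm_apply

theorem map_linEquiv_symm [F.Full] [F.Faithful] {V W : HopfMod k H A} (g : F.obj V ⟶ F.obj W) :
    F.map ((hF.linEquiv V W).symm (asHOM g)) = g := by
  rw [← hF.lin_apply]
  exact (hF.linEquiv V W).apply_symm_apply (asHOM g)

/-- The inverse of `F` on HOM is again a comodule map, so it sends the coinvariant `F(f)` to a
coinvariant, namely `f`. This serves for morphisms obtained as preimages under `F`. -/
theorem colinear_of_map (hF : ColinearFunctor F) [F.Full] [F.Faithful] {V W : HopfMod k H A} {f : V ⟶ W}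
    (hf : Colinear k H ((toLin (F.map f)).restrictScalars k)) :
    Colinear k H ((toLin f).restrictScalars k) := by
  rw [colinear_iff] at hf ⊢
  have h := hF.colinear_linEquiv_symm V W (asHOM (F.map f))
  have e : (hF.linEquiv V W).symm (asHOM (F.map f)) = asHOM f :=
    F.map_injective (hF.map_linEquiv_symm (F.map f))
  rw [hf, LinearMap.rTensor_tmul, LinearEquiv.coe_coe, e] at h
  exact h

/-! ### The bimodule `F(A)` and its pairing with `V`. -/

/-- The pairing `F(A) × V → F(V)`, `(n, v) ↦ F(a ↦ av)(n)`. -/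
def pairing (V : HopfMod k H A) :
    (F.obj (regular k H A)).carrier →ₗ[k] V.carrier →ₗ[k] (F.obj V).carrier :=
  (evalHOM (F.obj (regular k H A)) (F.obj V)).compl₂
    (hF.lin (regular k H A) V ∘ₗ pointHOM V)

theorem pairing_apply (V : HopfMod k H A) (n : (F.obj (regular k H A)).carrier) (v : V.carrier) :
    hF.pairing V n v = toLin (F.map (point v)) n := by
  rw [← hF.lin_apply]
  rfl

/-- The map `v ↦ F(a ↦ av)` is a composite of two colinear maps, and evaluation turns the coaction
on HOM into the diagonal one. This is where colinearity of `F` makes the comparison colinear. -/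
theorem rho_pairing (V : HopfMod k H A) (n : (F.obj (regular k H A)).carrier) (v : V.carrier) :
    rho k H (hF.pairing V n v) = diag k H (hF.pairing V) (rho k H n) (rho k H v) := by
  have h := ((hF.colinear_lin (regular k H A) V).comp (colinear_pointHOM V)) v
  have e : asHOM (F.map (point v)) = (hF.lin (regular k H A) V ∘ₗ pointHOM V) v :=
    (hF.lin_apply (point v)).symm
  rw [pairing_apply, rho_toLin, pairing, ← diag_rTensor, ← h, e]

theorem map_pairing {V W : HopfMod k H A} (f : V ⟶ W) (n : (F.obj (regular k H A)).carrier)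
    (v : V.carrier) : toLin (F.map f) (hF.pairing V n v) = hF.pairing W n (toLin f v) := by
  rw [pairing_apply, pairing_apply, ← toLin_comp, ← F.map_comp, point_comp]

theorem smul_pairing (V : HopfMod k H A) (b : B) (n : (F.obj (regular k H A)).carrier)
    (v : V.carrier) : hF.pairing V (b • n) v = b • hF.pairing V n v := by
  rw [pairing_apply, pairing_apply, map_smul]

/-- Naturality of the pairing (`map_pairing`) for the morphism `a ↦ av`. For `V = A` it is
associativity of the right action on `F(A)`; for general `V` it says that the pairing is balanced.
-/
theorem pairing_pairing (V : HopfMod k H A) (n : (F.obj (regular k H A)).carrier) (a : A)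
    (v : V.carrier) :
    hF.pairing V (hF.pairing (regular k H A) n a) v = hF.pairing V n (a • v) := by
  rw [hF.pairing_apply V, map_pairing, toLin_point]

/-- The right `A`-action `na = F(x ↦ xa)(n)` on `F(A)`. -/
abbrev rightModule : Module Aᵐᵒᵖ (F.obj (regular k H A)).carrier where
  smul a n := hF.pairing (regular k H A) n a.unop
  one_smul n := by
    change hF.pairing (regular k H A) n (1 : A) = n
    rw [pairing_apply, point_one, F.map_id, toLin_id]
  -- In the opposite ring `(a * b).unop = b.unop * a.unop`, hence the reversed arguments.
  mul_smul a b n := (hF.pairing_pairing (regular k H A) n b.unop a.unop).symm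
  smul_zero a := LinearMap.map_zero₂ _ _
  smul_add a n n' := LinearMap.map_add₂ _ _ _ _
  add_smul a b n := map_add (hF.pairing (regular k H A) n) a.unop b.unop
  zero_smul n := map_zero (hF.pairing (regular k H A) n)

/-- `F(A)` as a two-sided relative Hopf module. -/
def bimod : HopfBimod k H B A :=
  letI := hF.rightModule
  haveI : IsScalarTower k Aᵐᵒᵖ (F.obj (regular k H A)).carrier :=
    ⟨fun c a n => map_smul (hF.pairing (regular k H A) n) c a.unop⟩
  { toHopfMod := F.obj (regular k H A)
    comm := ⟨fun b a n => (hF.smul_pairing (regular k H A) b n a.unop).symm⟩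
    rightHopf := ⟨fun n a => hF.rho_pairing (regular k H A) n a⟩ }

/-- The balanced pairing `F(A) × V → F(V)`, `(n, v) ↦ F(a ↦ av)(n)`. -/
def act (V : HopfMod k H A) : hF.bimod.carrier →ₗ[k] V.carrier →ₗ[k] (F.obj V).carrier :=
  hF.pairing V

theorem act_apply (V : HopfMod k H A) (n : hF.bimod.carrier) (v : V.carrier) :
    hF.act V n v = toLin (F.map (point v)) n :=
  hF.pairing_apply V n v

theorem rho_act (V : HopfMod k H A) (n : hF.bimod.carrier) (v : V.carrier) :
    rho k H (hF.act V n v) = diag k H (hF.act V) (rho k H n) (rho k H v) :=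
  hF.rho_pairing V n v

theorem map_act {V W : HopfMod k H A} (f : V ⟶ W) (n : hF.bimod.carrier) (v : V.carrier) :
    toLin (F.map f) (hF.act V n v) = hF.act W n (toLin f v) :=
  hF.map_pairing f n v

theorem smul_act (V : HopfMod k H A) (b : B) (n : hF.bimod.carrier) (v : V.carrier) :
    hF.act V (b • n) v = b • hF.act V n v :=
  hF.smul_pairing V b n v

theorem op_smul (n : hF.bimod.carrier) (a : A) :
    MulOpposite.op a • n = hF.act (regular k H A) n a := rfl

theorem act_op_smul (V : HopfMod k H A) (n : hF.bimod.carrier) (a : A) (v : V.carrier) :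
    hF.act V (MulOpposite.op a • n) v = hF.act V n (a • v) :=
  hF.pairing_pairing V n a v

/-! ### The comparison `F(A) ⊗_A - → F` and its invertibility. -/

/-- The `k`-linear map `F(A) ⊗_A V → F(V)`, `n ⊗ v ↦ F(a ↦ av)(n)`. -/
def compareAux (V : HopfMod k H A) : (tensorObj hF.bimod V).carrier →ₗ[k] (F.obj V).carrier :=
  balLift k A hF.bimod.carrier V.carrier (hF.act V) (hF.act_op_smul V)

theorem compareAux_tmk (V : HopfMod k H A) (n : hF.bimod.carrier) (v : V.carrier) :
    hF.compareAux V (tmk hF.bimod V n v) = hF.act V n v :=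
  balLift_mk k A hF.bimod.carrier V.carrier (hF.act V) (hF.act_op_smul V) n v

/-- The map `F(A) ⊗_A V → F(V)`, `n ⊗ v ↦ F(a ↦ av)(n)`. -/
def compare (V : HopfMod k H A) : (tensorObj hF.bimod V).carrier →ₗ[B] (F.obj V).carrier :=
  { hF.compareAux V with
    map_smul' b x := by
      refine LinearMap.congr_fun (f := hF.compareAux V ∘ₗ leftAct k B _ b)
        (g := leftAct k B _ b ∘ₗ hF.compareAux V)
        (tensor_ext hF.bimod V fun n v => ?_) x
      simp only [LinearMap.comp_apply, leftAct_apply, smul_tmk, compareAux_tmk, smul_act] }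

theorem compare_tmk (V : HopfMod k H A) (n : hF.bimod.carrier) (v : V.carrier) :
    hF.compare V (tmk hF.bimod V n v) = hF.act V n v :=
  hF.compareAux_tmk V n v

theorem colinear_compare (V : HopfMod k H A) :
    Colinear k H ((hF.compare V).restrictScalars k) := by
  have h : (tmk hF.bimod V).compr₂ (hF.compareAux V) = hF.act V :=
    LinearMap.ext₂ fun n v => hF.compareAux_tmk V n v
  refine LinearMap.congr_fun (f := rho k H ∘ₗ hF.compareAux V)
    (g := (hF.compareAux V).rTensor H ∘ₗ rho k H)
    (tensor_ext hF.bimod V fun n v => ?_)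
  rw [LinearMap.comp_apply, LinearMap.comp_apply, compareAux_tmk, rho_tmk, rTensor_diag, h,
    rho_act]

/-- The natural transformation `F(A) ⊗_A - → F`. -/
def compareNat : tensorFunctor hF.bimod ⟶ F where
  app V := ofColinear (hF.compare V) (hF.colinear_compare V)
  naturality V W f := hom_ext fun x => by
    refine LinearMap.congr_fun
      (f := (hF.compare W ∘ₗ tensorMap hF.bimod V W (toLin f)).restrictScalars k)
      (g := (toLin (F.map f) ∘ₗ hF.compare V).restrictScalars k)
      (tensor_ext hF.bimod V fun n v => ?_) x
    simp only [LinearMap.restrictScalars_apply, LinearMap.comp_apply, tensorMap_tmk, compare_tmk,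
      map_act]

theorem compareNat_tmk (V : HopfMod k H A) (n : hF.bimod.carrier) (v : V.carrier) :
    toLin (hF.compareNat.app V) (tmk hF.bimod V n v) = hF.act V n v :=
  hF.compare_tmk V n v

/-- Only cancellation is proved, not surjectivity. Two morphisms that agree after the comparison
agree on all `F(a ↦ av)(n)`, and faithfulness of `F` recovers their values on each `v`. -/
theorem epi_compareNat [F.Full] [F.Faithful] [F.EssSurj] (V : HopfMod k H A) :
    Epi (hF.compareNat.app V) := by
  have key {Y : HopfMod k H A} (p q : V ⟶ Y)
      (h : hF.compareNat.app V ≫ F.map p = hF.compareNat.app V ≫ F.map q) : p = q := by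
    refine hom_ext fun v => point_injective (F.map_injective (hom_ext fun (n : hF.bimod.carrier) => ?_))
    have e : toLin (F.map p) (hF.act V n v) = toLin (F.map q) (hF.act V n v) := by
      rw [← compareNat_tmk]
      exact congrArg (fun f => toLin f (tmk hF.bimod V n v)) h
    rw [map_act, map_act, act_apply, act_apply] at e
    exact e
  refine ⟨fun {Z} p q h => ?_⟩
  -- Every target is isomorphic to some `F(Y)`, and by fullness every morphism into `F(Y)` is an
  -- `F(p)`, so `key` suffices.
  let e := F.objObjPreimageIso Z
  rw [← cancel_mono e.inv, ← F.map_preimage (p ≫ e.inv), ← F.map_preimage (q ≫ e.inv)]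
  congr 1
  refine key _ _ ?_
  rw [F.map_preimage, F.map_preimage, reassoc_of% h]

/-- Currying `g` gives `V → HOM_B(F(A), F(Y)) ≅ HOM_A(A, Y) ≅ Y`. Colinearity of `g` is needed at
once, since it places the curried maps in HOM, where full faithfulness of `F` can be used. -/
theorem exists_compareNat_comp [F.Full] [F.Faithful] {V Y : HopfMod k H A}
    (g : tensorObj hF.bimod V ⟶ F.obj Y) (hg : Colinear k H ((toLin g).restrictScalars k)) :
    ∃ y : V ⟶ Y, hF.compareNat.app V ≫ F.map y = g := by
  let c : V.carrier →ₗ[k] HOM k H B (F.obj (regular k H A)).carrier (F.obj Y).carrier :=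
    curryHOM (V := hF.bimod.toHopfMod) ((tmk hF.bimod V).compr₂ ((toLin g).restrictScalars k))
      (fun b n v => by
        change toLin g (tmk hF.bimod V (b • n) v) = b • toLin g (tmk hF.bimod V n v)
        rw [← smul_tmk, map_smul])
      (fun n v => by
        rw [← rTensor_diag, ← rho_tmk]
        exact hg _)
  have hc : Colinear k H c := colinear_curryHOM _ _ _
  let K := (hF.linEquiv (regular k H A) Y).symm.toLinearMap ∘ₗ c
  have hK : Colinear k H K := (hF.colinear_linEquiv_symm _ _).comp hc
  have hKc (v : V.carrier) (n : hF.bimod.carrier) :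
      toLin (F.map (K v)) n = toLin g (tmk hF.bimod V n v) := by
    have : F.map (K v) = c v := hF.map_linEquiv_symm _
    rw [this]
    rfl
  -- The identification `HOM_A(A, Y) ≅ Y` is evaluation at `1`.
  let y : V.carrier →ₗ[k] Y.carrier := evalHOM (regular k H A) Y (1 : A) ∘ₗ K
  have hy (v : V.carrier) : (K v : regular k H A ⟶ Y) = point (y v) := eq_point _
  have hact (n : hF.bimod.carrier) (v : V.carrier) :
      hF.act Y n (y v) = toLin g (tmk hF.bimod V n v) := by
    rw [act_apply, ← hy, hKc]
  let y' : V.carrier →ₗ[A] Y.carrier :=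
    { y with
      map_smul' a v := by
        change y (a • v) = a • y v
        -- Linearity is tested after applying `F` to points: both sides pair with `n` to the value
        -- of `g` on `n ⊗ av = na ⊗ v`.
        refine point_injective (F.map_injective (hom_ext fun (n : hF.bimod.carrier) => ?_))
        refine (hF.act_apply Y n _).symm.trans (Eq.trans ?_ (hF.act_apply Y n _))
        rw [← act_op_smul, hact, hact]
        exact congrArg (toLin g) (balMk_smul k A hF.bimod.carrier V.carrier n a v).symm }
  have hrho : Colinear k H y := fun v => by
    -- Since `1` is coinvariant, evaluation at `1` is colinear, and `y` inherits colinearity from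
    -- `K`.
    have h1 : rho k H (1 : A) = 1 ⊗ₜ (1 : H) := ComoduleAlgebra.coact_one
    change rho k H (toLin (K v : regular k H A ⟶ Y) (1 : A)) = y.rTensor H (rho k H v)
    rw [rho_toLin]
    change diag k H (evalHOM (regular k H A) Y) (rho k H (1 : A)) (rho k H (K v)) = _
    rw [h1, hK v, diag_tmul_one]
    exact (LinearMap.rTensor_comp_apply _ _ _ _).symm
  refine ⟨ofColinear y' hrho, hom_ext fun x => ?_⟩
  refine LinearMap.congr_fun
    (f := (toLin (F.map (ofColinear y' hrho)) ∘ₗ hF.compare V).restrictScalars k)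
    (g := (toLin g).restrictScalars k)
    (tensor_ext hF.bimod V fun n v => ?_) x
  simp only [LinearMap.restrictScalars_apply, LinearMap.comp_apply, compare_tmk, map_act]
  exact hact n v

/-- If `e` factors as the comparison followed by `F(y)`, then `F(y) ≫ e⁻¹` is a retraction of the
comparison. Split mono and epi give an isomorphism, with no appeal to exactness or direct sums. -/
theorem isIso_compareNat [F.Full] [F.Faithful] [F.EssSurj] (V : HopfMod k H A) {Y : HopfMod k H A}
    (e : (tensorFunctor hF.bimod).obj V ≅ F.obj Y) (he : Colinear k H ((toLin e.hom).restrictScalars k)) :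
    IsIso (hF.compareNat.app V) := by
  obtain ⟨y, hy⟩ := hF.exists_compareNat_comp e.hom he
  have := hF.epi_compareNat V
  have : IsSplitMono (hF.compareNat.app V) :=
    ⟨⟨⟨F.map y ≫ e.inv, by
      rw [← Category.assoc]
      exact (congrArg (· ≫ e.inv) hy).trans e.hom_inv_id⟩⟩⟩
  exact isIso_of_epi_of_isSplitMono _

end ColinearFunctor

theorem colinearIso_of_isIso {F G : HopfMod k H A ⥤ HopfMod k H B} (φ : G ⟶ F)
    (hφ : ∀ V, Colinear k H ((toLin (φ.app V)).restrictScalars k)) [∀ V, IsIso (φ.app V)] :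
    ColinearIso F G :=
  ⟨(NatIso.ofComponents (fun V => asIso (φ.app V)) fun f => φ.naturality f).symm,
    fun V => colinear_inv (asIso (φ.app V)) (hφ V)⟩

end ColinearFunctors

/-! ### The strict Morita context of a pair of inverse equivalences. -/

noncomputable section Morita

set_option linter.unusedSectionVars false

variable {k H A B : Type u} [CommRing k] [Ring H] [HopfAlgebra k H]
  [Ring A] [Algebra k A] [ComoduleAlgebra k H A] [Ring B] [Algebra k B] [ComoduleAlgebra k H B]
  [HasBijectiveAntipode k H] [Module.Projective k H]

theorem ColinearFunctor.isIso_compareNat_of_iso {T : HopfMod k H A ⥤ HopfMod k H B}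
    {U : HopfMod k H B ⥤ HopfMod k H A} (hT : ColinearFunctor T) [T.IsEquivalence]
    (hTU : ColinearIso (U ⋙ T) (𝟭 (HopfMod k H B))) (V : HopfMod k H A) :
    IsIso (hT.compareNat.app V) := by
  obtain ⟨ε, hε⟩ := hTU
  exact hT.isIso_compareNat V (Y := U.obj ((tensorFunctor hT.bimod).obj V)) (ε.app _).symm
    (colinear_inv (ε.app _) (hε _))

/-- Colinear inverse equivalences are induced by a strict Morita context on `T(A)` and `U(B)`. -/
theorem exists_moritaContext {T : HopfMod k H A ⥤ HopfMod k H B}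
    {U : HopfMod k H B ⥤ HopfMod k H A} (hT : ColinearFunctor T) (hU : ColinearFunctor U)
    (hUT : ColinearIso (T ⋙ U) (𝟭 (HopfMod k H A)))
    (hTU : ColinearIso (U ⋙ T) (𝟭 (HopfMod k H B))) :
    ∃ C : MoritaContext k H A B, C.IsStrict ∧
      ColinearIso T (tensorFunctor C.N) ∧ ColinearIso U (tensorFunctor C.M) := by
  obtain ⟨η, hη⟩ := id hUT
  obtain ⟨ε, hε⟩ := id hTU
  have : T.IsEquivalence := (CategoryTheory.Equivalence.mk T U η.symm ε).isEquivalence_functor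
  have : U.IsEquivalence := (CategoryTheory.Equivalence.mk T U η.symm ε).isEquivalence_inverse
  have iT := hT.isIso_compareNat_of_iso hTU
  have iU := hU.isIso_compareNat_of_iso hUT
  let ηA : U.obj (T.obj (regular k H A)) ⟶ regular k H A := η.hom.app (regular k H A)
  have hηA : Colinear k H ((toLin ηA).restrictScalars k) := hη _
  -- The given `ε` need not satisfy a triangle identity with `η`. The counit at `B` is therefore
  -- chosen so that `U(εB) = η_{U(B)}`.
  let εB : T.obj (U.obj (regular k H B)) ⟶ regular k H B :=
    U.preimage (η.hom.app (U.obj (regular k H B)))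
  have hεB' : U.map εB = η.hom.app (U.obj (regular k H B)) := U.map_preimage _
  have hεB : Colinear k H ((toLin εB).restrictScalars k) :=
    hU.colinear_of_map (by rw [hεB']; exact hη _)
  have : IsIso εB := by
    have : IsIso (U.map εB) := by rw [hεB']; infer_instance
    exact isIso_of_reflects_iso εB U
  have hη_nat {V W : HopfMod k H A} (f : V ⟶ W) :
      U.map (T.map f) ≫ η.hom.app W = η.hom.app V ≫ f := η.hom.naturality f
  have hη_app {V W : HopfMod k H A} (f : V ⟶ W) (x : (U.obj (T.obj V)).carrier) :
      toLin (η.hom.app W) (toLin (U.map (T.map f)) x) = toLin f (toLin (η.hom.app V) x) :=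
    congrArg (fun g => toLin g x) (hη_nat f)
  -- Naturality of `η` along `ηA` itself, with the isomorphism `ηA` cancelled.
  have hη_self : η.hom.app (U.obj (T.obj (regular k H A))) = U.map (T.map ηA) := by
    rw [← cancel_mono ηA]
    exact (hη_nat ηA).symm
  have hεB_nat (f : regular k H B ⟶ regular k H B) : T.map (U.map f) ≫ εB = εB ≫ f := by
    apply U.map_injective
    rw [U.map_comp, U.map_comp, hεB', hη_nat]
  -- By `hη_self`, `T(ηA)` is the adjusted counit at `T(A)`; this is naturality of that counit,
  -- checked after the faithful functor `U`.
  have hεB_map (f : regular k H B ⟶ T.obj (regular k H A)) :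
      T.map (U.map f) ≫ T.map ηA = εB ≫ f := by
    apply U.map_injective
    rw [U.map_comp, U.map_comp, hεB', ← hη_self, hη_nat]
  have hbijα : Function.Bijective (toLin (hU.compareNat.app (T.obj (regular k H A)) ≫ ηA)) :=
    bijective_toLin _
  have hbijβ : Function.Bijective (toLin (hT.compareNat.app (U.obj (regular k H B)) ≫ εB)) :=
    bijective_toLin _
  let α : (tensorObj hU.bimod hT.bimod.toHopfMod).carrier →ₗ[A] A :=
    toLin (hU.compareNat.app (T.obj (regular k H A)) ≫ ηA)
  let β : (tensorObj hT.bimod hU.bimod.toHopfMod).carrier →ₗ[B] B :=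
    toLin (hT.compareNat.app (U.obj (regular k H B)) ≫ εB)
  have hα (m : hU.bimod.carrier) (n : hT.bimod.carrier) :
      α (tmk hU.bimod hT.bimod.toHopfMod m n) =
        toLin ηA (hU.act (T.obj (regular k H A)) m n) :=
    congrArg (toLin ηA) (hU.compareNat_tmk (T.obj (regular k H A)) m n)
  have hβ (n : hT.bimod.carrier) (m : hU.bimod.carrier) :
      β (tmk hT.bimod hU.bimod.toHopfMod n m) =
        toLin εB (hT.act (U.obj (regular k H B)) n m) :=
    congrArg (toLin εB) (hT.compareNat_tmk (U.obj (regular k H B)) n m)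
  refine ⟨{ M := hU.bimod
            N := hT.bimod
            α := α
            β := β
            α_right := fun m n a => ?_
            β_right := fun n m b => ?_
            α_colinear := hηA.comp (hU.colinear_compare _)
            β_colinear := hεB.comp (hT.colinear_compare _)
            α_smul := fun m n m' => ?_
            β_smul := fun n m n' => ?_ },
    ⟨hbijα, hbijβ⟩,
    colinearIso_of_isIso hT.compareNat hT.colinear_compare,
    colinearIso_of_isIso hU.compareNat hU.colinear_compare⟩
  -- Acting by `a` on `N` is `T` of right multiplication by `a`; naturality of `η` moves it out to
  -- `A`.
  · rw [hα, hα, hT.op_smul, hT.act_apply]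
    refine (congrArg (toLin ηA) (hU.map_act _ m n).symm).trans ?_
    exact hη_app (point (V := regular k H A) a) _
  · rw [hβ, hβ, hU.op_smul, hU.act_apply]
    refine (congrArg (toLin εB) (hT.map_act _ n m).symm).trans ?_
    exact congrArg (fun g => toLin g (hT.act _ n m)) (hεB_nat (point (V := regular k H B) b))
  -- The element `mβ(n ⊗ m')` is `U(εB)` applied to the nested pairing of `m`, `n`, `m'`. Replacing
  -- `U(εB)` by `η_{U(B)}` reduces the identity to naturality of `η` along `a ↦ am'`.
  · rw [hα, hβ, hU.op_smul, ← hU.map_act, hεB']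
    refine ((congrArg (toLin (η.hom.app _)) ((congrArg (hU.act _ m) (hT.act_apply _ n m')).trans
      (hU.map_act _ m n).symm)).trans ?_).symm
    exact hη_app (point m') _
  -- The mirror image: `T(ηA)` acts as the counit at `T(A)`, and its naturality along `b ↦ bn'` is
  -- `hεB_map`.
  · rw [hα, hβ, hT.op_smul, ← hT.map_act]
    refine ((congrArg (toLin (T.map ηA)) ((congrArg (hT.act _ n) (hU.act_apply _ m n')).trans
      (hT.map_act _ n m).symm)).trans ?_).symm
    exact congrArg (fun g => toLin g (hT.act _ n m)) (hεB_map (point n'))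

end Morita
end HopfMorita

/-- The Hopf-Galois hypotheses are not needed: colinearity of the equivalences suffices. -/
theorem corollary8p7 {k H A B : Type u} [CommRing k] [Ring H] [HopfAlgebra k H]
    [HopfMorita.HasBijectiveAntipode k H] [Module.Projective k H]
    [Ring A] [Algebra k A] [HopfMorita.ComoduleAlgebra k H A]
    [Ring B] [Algebra k B] [HopfMorita.ComoduleAlgebra k H B]
    (hA : HopfMorita.IsHopfGalois k H A) (hB : HopfMorita.IsHopfGalois k H B)
    (T : HopfMorita.HopfMod k H A ⥤ HopfMorita.HopfMod k H B)
    (U : HopfMorita.HopfMod k H B ⥤ HopfMorita.HopfMod k H A)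
    (hT : HopfMorita.ColinearFunctor T) (hU : HopfMorita.ColinearFunctor U)
    (hUT : HopfMorita.ColinearIso (T ⋙ U) (𝟭 (HopfMorita.HopfMod k H A)))
    (hTU : HopfMorita.ColinearIso (U ⋙ T) (𝟭 (HopfMorita.HopfMod k H B))) :
    ∃ C : HopfMorita.MoritaContext k H A B, C.IsStrict ∧
      HopfMorita.ColinearIso T (HopfMorita.tensorFunctor C.N) ∧
      HopfMorita.ColinearIso U (HopfMorita.tensorFunctor C.M) :=
  HopfMorita.exists_moritaContext hT hU hUT hTU
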